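/- There is an absolute constant $C>0$ with the following property. Let $n\ge 2$ and let $\{\xi_{jk}\}_{1\le j\le k\le n}$ be independent real random variables with $\mathbf E\,\xi_{jk}=0$ and $\operatorname{Var}(\xi_{jk})=1$. Put $\xi_{jk}=\xi_{kj}$ for $k<j$, let $X_1\le\dots\le X_n$ be the eigenvalues (with multiplicity) of the random symmetric matrix $\Xi=\bigl(\tfrac{1}{\sqrt n}\xi_{jk}\bigr)_{j,k=1}^n$, and put $$F_n(x)=\tfrac1n\operatorname{card}\{i\le n: X_i\le x\},\qquad F(x)=\mathbf E\,F_n(x),\qquad x\in\mathbf R.$$ Let $\sigma\ge 0$. (i) If the distribution $\mu$ of every $\xi_{jk}$ satisfies the Poincaré-type inequality $\operatorname{PI}(\sigma^2)$, i.e. $\int g^2\,d\mu-\bigl(\int g\,d\mu\bigr)^2\le\sigma^2\int |g'|^2\,d\mu$ for all bounded smooth functions $g$ on $\mathbf R$, then $$\mathbf E\,W_1(F_n,F)=\mathbf E\int_{-\infty}^{+\infty}|F_n(x)-F(x)|\,dx\le\frac{C\sigma}{n^{2/3}}.$$ (ii) If the distribution $\mu$ of every $\xi_{jk}$ satisfies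 the logarithmic Sobolev inequality $\operatorname{LSI}(\sigma^2)$, i.e. $\int g^2\log g^2\,d\mu-\int g^2\,d\mu\,\log\int g^2\,d\mu\le 2\sigma^2\int |g'|^2\,d\mu$ for all bounded smooth functions $g$ on $\mathbf R$, then $$\mathbf E\,\|F_n-G\|\le C\Bigl(\frac{\sigma}{n}\Bigr)^{2/3}\log^{1/3}n+\|F-G\|,$$ where $\|H\|=\sup_{x\in\mathbf R}|H(x)|$ and $G$ is the distribution function of the semicircle law with density $\frac1{2\pi}\sqrt{4-x^2}$ on $[-2,2]$. -/

import Mathlib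

open MeasureTheory ProbabilityTheory
open scoped ENNReal

noncomputable section

/-- The Poincaré-type inequality `PI(c)` for a measure `μ` on the real line:
`Var_μ(g) ≤ c ∫ |g'|² dμ` for every bounded smooth `g`. When `∫ |g'|² dμ = ∞` the inequality
holds trivially, so only functions for which this integral is finite are mentioned. -/
def PoincareInequality (μ : Measure ℝ) (c : ℝ) : Prop :=
  ∀ g : ℝ → ℝ, ContDiff ℝ (⊤ : ℕ∞) g → (∃ K : ℝ, ∀ x, |g x| ≤ K) →
    Integrable (fun x => (deriv g x) ^ 2) μ →
    (∫ x, (g x) ^ 2 ∂μ) - (∫ x, g x ∂μ) ^ 2 ≤ c * ∫ x, (deriv g x) ^ 2 ∂μ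

/-- The entropy `Ent_μ(f) = ∫ f log f dμ - (∫ f dμ) log (∫ f dμ)` of a function `f ≥ 0`
(with `0 log 0 = 0`). -/
def entropyFunctional (μ : Measure ℝ) (f : ℝ → ℝ) : ℝ :=
  (∫ x, f x * Real.log (f x) ∂μ) - (∫ x, f x ∂μ) * Real.log (∫ x, f x ∂μ)

/-- The logarithmic Sobolev inequality `LSI(c)` for a measure `μ` on the real line:
`Ent_μ(g²) ≤ 2 c ∫ |g'|² dμ` for every bounded smooth `g` (trivial when the right-hand
integral is infinite). -/
def LogSobolevInequality (μ : Measure ℝ) (c : ℝ) : Prop :=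
  ∀ g : ℝ → ℝ, ContDiff ℝ (⊤ : ℕ∞) g → (∃ K : ℝ, ∀ x, |g x| ≤ K) →
    Integrable (fun x => (deriv g x) ^ 2) μ →
    entropyFunctional μ (fun x => (g x) ^ 2) ≤ 2 * c * ∫ x, (deriv g x) ^ 2 ∂μ

/-- The positions `(j, k)` with `j ≤ k`: on and above the diagonal of an `n × n` matrix. -/
abbrev UpperIndex (n : ℕ) : Type := {p : Fin n × Fin n // p.1 ≤ p.2}

/-- The symmetric matrix `(a_{jk} / √n)`, where `a` is given for `j ≤ k` and extended by
`a_{jk} = a_{kj}`. -/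
def wignerMatrix {n : ℕ} (a : UpperIndex n → ℝ) : Matrix (Fin n) (Fin n) ℝ :=
  Matrix.of fun j k => a ⟨(min j k, max j k), min_le_max⟩ / √(n : ℝ)

theorem wignerMatrix_isHermitian {n : ℕ} (a : UpperIndex n → ℝ) :
    (wignerMatrix a).IsHermitian := by
  ext j k
  simp [wignerMatrix, min_comm, max_comm]

/-- The empirical distribution function `x ↦ card {i : X i ≤ x} / n` of `X 1, …, X n`. -/
def empiricalCDF {n : ℕ} (X : Fin n → ℝ) (x : ℝ) : ℝ :=
  ((Finset.univ.filter fun i => X i ≤ x).card : ℝ) / n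

/-- The spectral empirical distribution function of `(a_{jk} / √n)`; eigenvalues are counted
with multiplicity. -/
def spectralCDF {n : ℕ} (a : UpperIndex n → ℝ) : ℝ → ℝ :=
  empiricalCDF (wignerMatrix_isHermitian a).eigenvalues

/-- The mean `F = E F_n` of the spectral empirical distribution functions of the random matrix
`(ξ_{jk} / √n)`. -/
def meanSpectralCDF {Ω : Type*} [MeasurableSpace Ω] (P : Measure Ω) {n : ℕ}
    (ξ : UpperIndex n → Ω → ℝ) (x : ℝ) : ℝ :=
  ∫ ω, spectralCDF (fun p => ξ p ω) x ∂P

/-- The distribution function of the standard semicircle law, with density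
`√(4 - t²) / (2π)` on `[-2, 2]`. -/
def semicircleCDF (x : ℝ) : ℝ :=
  ∫ t in Set.Iic x, (Set.Icc (-2 : ℝ) 2).indicator
    (fun t => √(4 - t ^ 2) / (2 * Real.pi)) t

/-- The Kantorovich–Rubinstein distance `W₁(F, G) = ∫ |F(x) - G(x)| dx`, in `[0, ∞]`. -/
def kantorovichDist (F G : ℝ → ℝ) : ℝ≥0∞ :=
  ∫⁻ x, ENNReal.ofReal |F x - G x|

/-- The Kolmogorov distance `‖F - G‖ = sup_x |F(x) - G(x)|`, in `[0, ∞]`. -/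
def kolmogorovDist (F G : ℝ → ℝ) : ℝ≥0∞ :=
  ⨆ x : ℝ, ENNReal.ofReal |F x - G x|

end

/-!
The two bounds rest on the same three ingredients.

*Gradients of linear statistics.* For a symmetric matrix `A` with eigenvalues `λᵢ`, the linear
spectral statistic `linStat f = n⁻¹ ∑ f(λᵢ)` is differentiable in each entry, with derivative `n⁻¹
tr(f'(A) ∂A)`. All traces that occur are averages over the overlaps `⟨uᵢ, vⱼ⟩²` of two eigenbases
(`trace_specFun_mul_specFun`), which reduces the Taylor estimate `abs_trace_taylor_le` to the
scalar one; no perturbation theory of individual eigenvalues is needed. The squared gradient is at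
most `2 n⁻² linStat (f'²)` (`sum_linStatGrad_sq_le`): what matters is the mean of `f'²` against
the spectral measure, not its supremum.

*Tensorization.* Variance and entropy are subadditive over product measures (`phiEntropy_pi_le`),
and `PI` and `LSI` extend from smooth to `C¹` functions by mollification. Hence the variance of
`linStat f` is at most `2σ² n⁻² E linStat (f'²)` (`variance_linStat_le`), with an analogous
entropy bound for `exp (t linStat f)` (`entropy_exp_linStat_le`).

*Ramps.* The empirical distribution function at `x` is compared with `linStat` of a smooth cutoff
falling from `1` to `0` on `[x, x + h]`.

Under `PI`, the comparison costs `h` in `L¹(dx)`. The variance at `x` is of order `σ² n⁻² h⁻²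
E(Fₙ(x + h) - Fₙ(x))`; integrated in `x` against the weight `1 + x²` it gives `σ² n⁻² h⁻¹`, as the
second moment of the mean spectral measure is `1`. Cauchy–Schwarz against `(1 + x²)⁻¹`, in the
linearized form `E|X - EX| ≤ s + Var(X) / s`, bounds the mean `L¹` fluctuation by a multiple of `σ
/ (n √h)`, and `h = n^(-2/3)` balances the terms.

Under `LSI`, let the ramp `m` travel with the exponent: if `σ² n⁻² m'² + r m' ≤ 0`, then `t⁻¹ log
E exp(t linStat (m(· + r t)))` is nonincreasing in `t`, which compares the exponential moment of
the final ramp with the mean of the initial one (`integral_exp_linStat_le`). For a ramp of width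
`h = (σ/n)^(2/3) (log n)^(1/3)` and `T = log n / h` the ramp travels a distance of order `h` only.
The mean of the initial ramp is at most `G(x) + ‖F - G‖ + O(h)`, and a union bound over `n + 1`
points of `[-2, 2]` costs `log (2 (n + 1)) / T = O(h)`. The norm `‖F - G‖` enters through means
only, which is why its constant is one.
-/

noncomputable section

/-! ### Functions of symmetric matrices -/

section HilbertSchmidt

variable {ι : Type*} [Fintype ι]

/-- The squared Hilbert–Schmidt norm of a real matrix. -/
def hsSq (N : Matrix ι ι ℝ) : ℝ := ∑ j, ∑ k, N j k ^ 2

theorem hsSq_nonneg (N : Matrix ι ι ℝ) : 0 ≤ hsSq N :=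
  Finset.sum_nonneg fun _ _ => Finset.sum_nonneg fun _ _ => sq_nonneg _

theorem hsSq_eq_trace {N : Matrix ι ι ℝ} (h : N.transpose = N) : hsSq N = (N * N).trace := by
  simp only [hsSq, Matrix.trace, Matrix.diag_apply, Matrix.mul_apply]
  refine Finset.sum_congr rfl fun i _ => Finset.sum_congr rfl fun j _ => ?_
  conv_rhs => rw [← h, Matrix.transpose_apply, Matrix.transpose_apply]
  rw [← Matrix.transpose_apply N, h]; ring

theorem trace_mul_sq_le (M N : Matrix ι ι ℝ) (hN : N.transpose = N) :
    (M * N).trace ^ 2 ≤ hsSq M * hsSq N := by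
  have h : (M * N).trace = ∑ p : ι × ι, M p.1 p.2 * N p.1 p.2 := by
    simp only [Matrix.trace, Matrix.diag_apply, Matrix.mul_apply, Fintype.sum_prod_type]
    refine Finset.sum_congr rfl fun i _ => Finset.sum_congr rfl fun j _ => ?_
    conv_lhs => rw [← hN, Matrix.transpose_apply]
  rw [h, hsSq, hsSq, ← Fintype.sum_prod_type' (fun i j => M i j ^ 2),
    ← Fintype.sum_prod_type' (fun i j => N i j ^ 2)]
  exact Finset.sum_mul_sq_le_sq_mul_sq _ _ _

end HilbertSchmidt

section SpectralCalculus

variable {ι : Type*} [Fintype ι] [DecidableEq ι] {A B : Matrix ι ι ℝ}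

/-- The function `g` of a real symmetric matrix: `U diag(g(λ)) Uᵀ`, where `U` is the matrix of an
orthonormal eigenbasis. -/
def specFun (hA : A.IsHermitian) (g : ℝ → ℝ) : Matrix ι ι ℝ :=
  (hA.eigenvectorUnitary : Matrix ι ι ℝ) * Matrix.diagonal (fun i => g (hA.eigenvalues i)) *
    star (hA.eigenvectorUnitary : Matrix ι ι ℝ)

/-- The squared entries `⟨uᵢ, vⱼ⟩²` of the transition matrix between the eigenbasis `u` of `B` and
the eigenbasis `v` of `A`. -/
def overlap (hB : B.IsHermitian) (hA : A.IsHermitian) (i j : ι) : ℝ :=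
  ((star (hB.eigenvectorUnitary : Matrix ι ι ℝ) * (hA.eigenvectorUnitary : Matrix ι ι ℝ)) i j) ^ 2

theorem overlap_nonneg (hB : B.IsHermitian) (hA : A.IsHermitian) (i j : ι) :
    0 ≤ overlap hB hA i j := sq_nonneg _

theorem trace_specFun_mul_specFun (hB : B.IsHermitian) (hA : A.IsHermitian) (g k : ℝ → ℝ) :
    (specFun hB g * specFun hA k).trace =
      ∑ i, ∑ j, overlap hB hA i j * (g (hB.eigenvalues i) * k (hA.eigenvalues j)) := by
  set U := (hB.eigenvectorUnitary : Matrix ι ι ℝ) with hU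
  set V := (hA.eigenvectorUnitary : Matrix ι ι ℝ) with hV
  set G := Matrix.diagonal (fun i => g (hB.eigenvalues i))
  set K := Matrix.diagonal (fun i => k (hA.eigenvalues i))
  have h1 : (specFun hB g * specFun hA k).trace = (G * (star U * V) * K * star (star U * V)).trace := by
    have : specFun hB g * specFun hA k = U * (G * (star U * V) * K * star V) := by
      simp only [specFun, ← hU, ← hV]
      simp only [Matrix.mul_assoc]
      rfl
    rw [this, Matrix.trace_mul_comm, star_mul, star_star]
    simp only [Matrix.mul_assoc]
  rw [h1]
  simp only [Matrix.trace, Matrix.diag_apply]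
  refine Finset.sum_congr rfl fun i _ => ?_
  rw [Matrix.mul_apply]
  refine Finset.sum_congr rfl fun j _ => ?_
  rw [Matrix.mul_diagonal, Matrix.diagonal_mul, overlap, ← hU, ← hV, Matrix.star_apply,
    show ∀ x : ℝ, star x = x from fun _ => rfl]
  ring

theorem specFun_one (hA : A.IsHermitian) : specFun hA (fun _ => 1) = 1 := by
  have h : (hA.eigenvectorUnitary : Matrix ι ι ℝ) *
      star (hA.eigenvectorUnitary : Matrix ι ι ℝ) = 1 := Unitary.coe_mul_star_self _
  simp [specFun, h]

theorem specFun_id (hA : A.IsHermitian) : specFun hA (fun x => x) = A := by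
  have h := hA.spectral_theorem
  rw [Unitary.conjStarAlgAut_apply] at h
  conv_rhs => rw [h]
  rfl

theorem trace_specFun (hA : A.IsHermitian) (g : ℝ → ℝ) :
    (specFun hA g).trace = ∑ i, g (hA.eigenvalues i) := by
  have h : star (hA.eigenvectorUnitary : Matrix ι ι ℝ) *
      (hA.eigenvectorUnitary : Matrix ι ι ℝ) = 1 := Unitary.coe_star_mul_self _
  rw [specFun, Matrix.trace_mul_comm, ← Matrix.mul_assoc, h, Matrix.one_mul, Matrix.trace_diagonal]

theorem specFun_transpose (hA : A.IsHermitian) (g : ℝ → ℝ) :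
    (specFun hA g).transpose = specFun hA g := by
  simp [specFun, Matrix.transpose_mul, Matrix.star_eq_conjTranspose,
    Matrix.conjTranspose_eq_transpose_of_trivial, Matrix.mul_assoc]

theorem specFun_mul (hA : A.IsHermitian) (g k : ℝ → ℝ) :
    specFun hA g * specFun hA k = specFun hA (fun x => g x * k x) := by
  set U := (hA.eigenvectorUnitary : Matrix ι ι ℝ) with hU
  have h : star U * U = 1 := Unitary.coe_star_mul_self _
  simp only [specFun, ← hU]
  calc _ = U * Matrix.diagonal (fun i => g (hA.eigenvalues i)) * (star U * U) *
        Matrix.diagonal (fun i => k (hA.eigenvalues i)) * star U := by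
        simp only [Matrix.mul_assoc]
    _ = _ := by
        rw [h, Matrix.mul_one, Matrix.mul_assoc U, Matrix.diagonal_mul_diagonal]

theorem sum_overlap_left (hB : B.IsHermitian) (hA : A.IsHermitian) (g : ℝ → ℝ) :
    ∑ i, ∑ j, overlap hB hA i j * g (hB.eigenvalues i) = ∑ i, g (hB.eigenvalues i) := by
  have h := trace_specFun_mul_specFun hB hA g (fun _ => 1)
  rw [specFun_one, Matrix.mul_one, trace_specFun] at h
  simpa using h.symm

theorem sum_overlap_right (hB : B.IsHermitian) (hA : A.IsHermitian) (g : ℝ → ℝ) :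
    ∑ i, ∑ j, overlap hB hA i j * g (hA.eigenvalues j) = ∑ i, g (hA.eigenvalues i) := by
  have h := trace_specFun_mul_specFun hB hA (fun _ => 1) g
  rw [specFun_one, Matrix.one_mul, trace_specFun] at h
  simpa using h.symm

theorem hsSq_specFun (hA : A.IsHermitian) (g : ℝ → ℝ) :
    hsSq (specFun hA g) = ∑ i, g (hA.eigenvalues i) ^ 2 := by
  rw [hsSq_eq_trace (specFun_transpose hA g), specFun_mul, trace_specFun]
  simp only [sq]

theorem hsSq_specFun_sub (hB : B.IsHermitian) (hA : A.IsHermitian) (g k : ℝ → ℝ) :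
    hsSq (specFun hB g - specFun hA k) =
      ∑ i, ∑ j, overlap hB hA i j * (g (hB.eigenvalues i) - k (hA.eigenvalues j)) ^ 2 := by
  have h1 := sum_overlap_left hB hA (fun x => g x ^ 2)
  have h2 := sum_overlap_right hB hA (fun x => k x ^ 2)
  have h3 := trace_specFun_mul_specFun hB hA g k
  have ht : (specFun hB g - specFun hA k).transpose = specFun hB g - specFun hA k := by
    rw [Matrix.transpose_sub, specFun_transpose, specFun_transpose]
  have e : ∑ i, ∑ j, overlap hB hA i j * (g (hB.eigenvalues i) - k (hA.eigenvalues j)) ^ 2 =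
      ∑ i, g (hB.eigenvalues i) ^ 2 + ∑ i, k (hA.eigenvalues i) ^ 2
        - 2 * (specFun hB g * specFun hA k).trace := by
    rw [← h1, ← h2, h3, Finset.mul_sum, ← Finset.sum_add_distrib, ← Finset.sum_sub_distrib]
    refine Finset.sum_congr rfl fun i _ => ?_
    rw [Finset.mul_sum, ← Finset.sum_add_distrib, ← Finset.sum_sub_distrib]
    refine Finset.sum_congr rfl fun j _ => ?_
    ring
  rw [e, hsSq_eq_trace ht, Matrix.sub_mul, Matrix.mul_sub, Matrix.mul_sub, specFun_mul, specFun_mul,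
    Matrix.trace_sub, Matrix.trace_sub, Matrix.trace_sub, trace_specFun, trace_specFun,
    Matrix.trace_mul_comm (specFun hA k)]
  simp only [sq]
  ring

theorem hsSq_sub (hB : B.IsHermitian) (hA : A.IsHermitian) :
    hsSq (B - A) =
      ∑ i, ∑ j, overlap hB hA i j * (hB.eigenvalues i - hA.eigenvalues j) ^ 2 := by
  have h := hsSq_specFun_sub hB hA (fun x => x) (fun x => x)
  rwa [specFun_id, specFun_id] at h

/-- A `K`-Lipschitz function acts on symmetric matrices as a `K`-Lipschitz map for the
Hilbert–Schmidt norm. -/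
theorem hsSq_specFun_sub_le (hB : B.IsHermitian) (hA : A.IsHermitian) {g : ℝ → ℝ} {K : ℝ}
    (hg : ∀ x y, |g x - g y| ≤ K * |x - y|) :
    hsSq (specFun hB g - specFun hA g) ≤ K ^ 2 * hsSq (B - A) := by
  rw [hsSq_specFun_sub, hsSq_sub hB hA, Finset.mul_sum]
  refine Finset.sum_le_sum fun i _ => ?_
  rw [Finset.mul_sum]
  refine Finset.sum_le_sum fun j _ => ?_
  have h := hg (hB.eigenvalues i) (hA.eigenvalues j)
  have h2 := pow_le_pow_left₀ (abs_nonneg _) h 2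
  rw [mul_pow, sq_abs, sq_abs] at h2
  nlinarith [mul_le_mul_of_nonneg_left h2 (overlap_nonneg hB hA i j)]

/-- Second-order Taylor estimate for `A ↦ tr f(A)`. All three terms on the left are averages of
`f(μᵢ)`, `f(λⱼ)` and `f'(λⱼ)(μᵢ - λⱼ)` over the overlaps of the two eigenbases, so the scalar
estimate applies term by term. -/
theorem abs_trace_taylor_le (hB : B.IsHermitian) (hA : A.IsHermitian) {f f' : ℝ → ℝ} {K : ℝ}
    (hf : ∀ x y, |f y - f x - f' x * (y - x)| ≤ K * (y - x) ^ 2) :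
    |∑ i, f (hB.eigenvalues i) - ∑ i, f (hA.eigenvalues i) - (specFun hA f' * (B - A)).trace|
      ≤ K * hsSq (B - A) := by
  have h1 := sum_overlap_left hB hA f
  have h2 := sum_overlap_right hB hA f
  have h3 := trace_specFun_mul_specFun hB hA (fun x => x) f'
  have h4 := sum_overlap_right hB hA (fun x => f' x * x)
  rw [specFun_id] at h3
  have e : (specFun hA f' * (B - A)).trace =
      ∑ i, ∑ j, overlap hB hA i j *
        (f' (hA.eigenvalues j) * (hB.eigenvalues i - hA.eigenvalues j)) := by
    have h5 : (specFun hA f' * A).trace = ∑ i, f' (hA.eigenvalues i) * hA.eigenvalues i := by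
      rw [← trace_specFun hA (fun x => f' x * x), ← specFun_mul hA f' (fun x => x), specFun_id]
    rw [Matrix.mul_sub, Matrix.trace_sub, Matrix.trace_mul_comm, h3, h5, ← h4,
      ← Finset.sum_sub_distrib]
    refine Finset.sum_congr rfl fun i _ => ?_
    rw [← Finset.sum_sub_distrib]
    exact Finset.sum_congr rfl fun j _ => by ring
  rw [← h1, ← h2, e, hsSq_sub hB hA, ← Finset.sum_sub_distrib, ← Finset.sum_sub_distrib,
    Finset.mul_sum]
  refine (Finset.abs_sum_le_sum_abs _ _).trans (Finset.sum_le_sum fun i _ => ?_)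
  rw [← Finset.sum_sub_distrib, ← Finset.sum_sub_distrib, Finset.mul_sum]
  refine (Finset.abs_sum_le_sum_abs _ _).trans (Finset.sum_le_sum fun j _ => ?_)
  rw [← mul_sub, ← mul_sub, abs_mul, abs_of_nonneg (overlap_nonneg hB hA i j)]
  nlinarith [mul_le_mul_of_nonneg_left (hf (hA.eigenvalues j) (hB.eigenvalues i))
    (overlap_nonneg hB hA i j)]

end SpectralCalculus

/-! ### Linear spectral statistics of the symmetric matrix with given entries -/

section Wigner

variable {n : ℕ}

/-- The linear spectral statistic `n⁻¹ ∑ f(λᵢ)` of the symmetric matrix built from `a`, i.e. the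
integral of `f` against the spectral empirical measure. -/
def linStat (f : ℝ → ℝ) (a : UpperIndex n → ℝ) : ℝ :=
  (∑ i, f ((wignerMatrix_isHermitian a).eigenvalues i)) / n

/-- The `p`-th partial derivative `n⁻¹ tr(f'(A) ∂ₚA)` of the linear spectral statistic of `f`, written
as a function of `g = f'`. -/
def linStatGrad (g : ℝ → ℝ) (p : UpperIndex n) (a : UpperIndex n → ℝ) : ℝ :=
  (specFun (wignerMatrix_isHermitian a) g * wignerMatrix (Pi.single p 1)).trace / n

theorem wignerMatrix_sub (a b : UpperIndex n → ℝ) :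
    wignerMatrix (a - b) = wignerMatrix a - wignerMatrix b := by
  ext j k; simp [wignerMatrix, sub_div]

theorem wignerMatrix_smul (c : ℝ) (a : UpperIndex n → ℝ) :
    wignerMatrix (c • a) = c • wignerMatrix a := by
  ext j k; simp [wignerMatrix, mul_div_assoc]

theorem wignerMatrix_transpose (a : UpperIndex n → ℝ) :
    (wignerMatrix a).transpose = wignerMatrix a := by
  have h := wignerMatrix_isHermitian a
  rwa [Matrix.IsHermitian, Matrix.conjTranspose_eq_transpose_of_trivial] at h

theorem wignerMatrix_update_sub (a : UpperIndex n → ℝ) (p : UpperIndex n) (s t : ℝ) :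
    wignerMatrix (Function.update a p t) - wignerMatrix (Function.update a p s) =
      (t - s) • wignerMatrix (Pi.single p (1 : ℝ)) := by
  rw [← wignerMatrix_sub, ← wignerMatrix_smul]
  congr 1
  ext q
  by_cases h : q = p
  · subst h; simp
  · simp [h]

theorem trace_mul_wignerMatrix (N : Matrix (Fin n) (Fin n) ℝ) (a : UpperIndex n → ℝ) :
    (N * wignerMatrix a).trace = ∑ p, a p * (N * wignerMatrix (Pi.single p 1)).trace := by
  have h : wignerMatrix a = ∑ p, a p • wignerMatrix (Pi.single p (1 : ℝ)) := by
    ext j k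
    rw [Matrix.sum_apply]
    simp only [wignerMatrix, Matrix.smul_apply, Matrix.of_apply, Pi.single_apply, smul_eq_mul]
    rw [Finset.sum_eq_single ⟨(min j k, max j k), min_le_max⟩]
    · simp [div_eq_mul_inv]
    · intro b _ hb
      rw [if_neg (fun h => hb h.symm)]; simp
    · simp
  conv_lhs => rw [h]
  rw [Matrix.mul_sum, Matrix.trace_sum]
  simp [Matrix.trace_smul]

theorem sum_min_max_le (φ : UpperIndex n → ℝ) (hφ : ∀ p, 0 ≤ φ p) :
    ∑ j, ∑ k, φ ⟨(min j k, max j k), min_le_max⟩ ≤ 2 * ∑ p, φ p := by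
  rw [← Fintype.sum_prod_type' (fun j k => φ ⟨(min j k, max j k), min_le_max⟩)]
  let g : Fin n × Fin n → ℝ := fun q => if h : q.1 ≤ q.2 then φ ⟨q, h⟩ else 0
  let g' : Fin n × Fin n → ℝ := fun q => if h : q.2 ≤ q.1 then φ ⟨(q.2, q.1), h⟩ else 0
  have hg : ∑ p, φ p = ∑ q, g q := by
    refine Fintype.sum_of_injective (fun p : UpperIndex n => p.1) Subtype.val_injective _ _ ?_ ?_
    · intro q hq
      have : ¬ q.1 ≤ q.2 := fun h => hq ⟨⟨q, h⟩, rfl⟩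
      simp [g, this]
    · intro p; simp [g, p.2]
  have hg' : ∑ p, φ p = ∑ q, g' q := by
    refine Fintype.sum_of_injective (fun p : UpperIndex n => (p.1.2, p.1.1)) ?_ _ _ ?_ ?_
    · intro p q h
      simp only [Prod.mk.injEq] at h
      exact Subtype.ext (Prod.ext h.2 h.1)
    · intro q hq
      have : ¬ q.2 ≤ q.1 := fun h => hq ⟨⟨(q.2, q.1), h⟩, rfl⟩
      simp [g', this]
    · intro p; simp [g', p.2]
  rw [two_mul]
  nth_rewrite 1 [hg]
  rw [hg', ← Finset.sum_add_distrib]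
  refine Finset.sum_le_sum fun q _ => ?_
  obtain ⟨j, k⟩ := q
  have h1 : 0 ≤ g (j, k) := by simp only [g]; split_ifs <;> simp [hφ]
  have h2 : 0 ≤ g' (j, k) := by simp only [g']; split_ifs <;> simp [hφ]
  rcases le_total j k with h | h
  · have : φ ⟨(min j k, max j k), min_le_max⟩ = g (j, k) := by simp [g, h]
    linarith
  · have : φ ⟨(min j k, max j k), min_le_max⟩ = g' (j, k) := by simp [g', h]
    linarith

theorem hsSq_wignerMatrix_eq (a : UpperIndex n → ℝ) :
    hsSq (wignerMatrix a) = (∑ j, ∑ k, a ⟨(min j k, max j k), min_le_max⟩ ^ 2) / n := by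
  simp only [hsSq, wignerMatrix, Matrix.of_apply, div_pow, Real.sq_sqrt (Nat.cast_nonneg n),
    Finset.sum_div]

theorem hsSq_wignerMatrix_le (a : UpperIndex n → ℝ) :
    hsSq (wignerMatrix a) ≤ 2 / n * ∑ p, a p ^ 2 := by
  rw [hsSq_wignerMatrix_eq, div_mul_eq_mul_div]
  gcongr
  exact sum_min_max_le (fun p => a p ^ 2) fun p => sq_nonneg _

/-- The squared gradient of a linear spectral statistic is at most `2/n²` times the linear statistic
of the squared derivative. The sum of squares `∑ dₚ²` is itself the pairing of `f'(A)` with the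
symmetric matrix built from `d`, so that Cauchy–Schwarz gives the bound. -/
theorem sum_linStatGrad_sq_le (g : ℝ → ℝ) (a : UpperIndex n → ℝ) :
    ∑ p, linStatGrad g p a ^ 2 ≤ 2 / (n : ℝ) ^ 2 * linStat (fun x => g x ^ 2) a := by
  set N := specFun (wignerMatrix_isHermitian a) g with hN
  let d : UpperIndex n → ℝ := fun p => (N * wignerMatrix (Pi.single p 1)).trace
  set s := ∑ p, d p ^ 2 with hs
  have hs0 : 0 ≤ s := Finset.sum_nonneg fun _ _ => sq_nonneg _
  have h1 : (N * wignerMatrix d).trace = s := by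
    rw [trace_mul_wignerMatrix]
    exact Finset.sum_congr rfl fun p _ => (sq (d p)).symm
  have h2 : s ^ 2 ≤ hsSq N * (2 / n * s) := by
    rw [← h1]
    refine (trace_mul_sq_le N _ (wignerMatrix_transpose d)).trans ?_
    rw [h1]
    exact mul_le_mul_of_nonneg_left (hsSq_wignerMatrix_le d) (hsSq_nonneg _)
  have h3 : s ≤ 2 / n * hsSq N := by
    rcases hs0.eq_or_lt with h | h
    · rw [← h]; have := hsSq_nonneg N; positivity
    · refine le_of_mul_le_mul_right ?_ h
      nlinarith
  have h4 : ∑ p, linStatGrad g p a ^ 2 = s / (n : ℝ) ^ 2 := by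
    rw [hs, Finset.sum_div]
    exact Finset.sum_congr rfl fun p _ => div_pow _ _ _
  rw [h4, linStat, ← hsSq_specFun, ← hN]
  calc s / (n : ℝ) ^ 2 ≤ (2 / n * hsSq N) / (n : ℝ) ^ 2 := by gcongr
    _ = _ := by ring

theorem continuous_specFun_wignerMatrix {g : ℝ → ℝ} {K : ℝ}
    (hg : ∀ x y, |g x - g y| ≤ K * |x - y|) :
    Continuous fun a : UpperIndex n → ℝ => specFun (wignerMatrix_isHermitian a) g := by
  refine continuous_matrix fun j k => continuous_iff_continuousAt.2 fun b => ?_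
  have hc : Continuous fun a : UpperIndex n → ℝ => √(K ^ 2 * (2 / n * ∑ p, (a p - b p) ^ 2)) := by
    fun_prop
  have h0 := hc.tendsto b
  simp only [sub_self, ne_eq, OfNat.ofNat_ne_zero, not_false_eq_true, zero_pow,
    Finset.sum_const_zero, mul_zero, Real.sqrt_zero] at h0
  rw [ContinuousAt, tendsto_iff_dist_tendsto_zero]
  refine squeeze_zero (fun _ => dist_nonneg) (fun a => ?_) h0
  rw [Real.dist_eq]
  refine Real.abs_le_sqrt ?_
  set N := specFun (wignerMatrix_isHermitian a) g - specFun (wignerMatrix_isHermitian b) g with hN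
  have h1 : N j k ^ 2 ≤ hsSq N := by
    refine (Finset.single_le_sum (f := fun k => N j k ^ 2) (fun _ _ => sq_nonneg _)
      (Finset.mem_univ k)).trans ?_
    exact Finset.single_le_sum (f := fun j => ∑ k, N j k ^ 2)
      (fun _ _ => Finset.sum_nonneg fun _ _ => sq_nonneg _) (Finset.mem_univ j)
  have h2 := hsSq_specFun_sub_le (wignerMatrix_isHermitian a) (wignerMatrix_isHermitian b) hg
  rw [← wignerMatrix_sub] at h2
  have h3 := hsSq_wignerMatrix_le (a - b)
  calc _ = N j k ^ 2 := by rw [hN, Matrix.sub_apply]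
    _ ≤ K ^ 2 * hsSq (wignerMatrix (a - b)) := h1.trans h2
    _ ≤ _ := mul_le_mul_of_nonneg_left h3 (sq_nonneg K)

theorem linStat_eq_trace (g : ℝ → ℝ) (a : UpperIndex n → ℝ) :
    linStat g a = (specFun (wignerMatrix_isHermitian a) g).trace / n := by
  rw [linStat, trace_specFun]

theorem continuous_linStat {g : ℝ → ℝ} {K : ℝ} (hg : ∀ x y, |g x - g y| ≤ K * |x - y|) :
    Continuous (linStat (n := n) g) := by
  have h := (continuous_specFun_wignerMatrix (n := n) hg).matrix_trace.div_const (n : ℝ)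
  exact h.congr fun a => (linStat_eq_trace g a).symm

theorem continuous_linStatGrad {g : ℝ → ℝ} {K : ℝ} (hg : ∀ x y, |g x - g y| ≤ K * |x - y|)
    (p : UpperIndex n) : Continuous (linStatGrad g p) :=
  ((continuous_specFun_wignerMatrix (n := n) hg).matrix_mul continuous_const).matrix_trace.div_const
    (n : ℝ)

theorem taylor_of_lipschitz_deriv {f f' : ℝ → ℝ} {K : ℝ} (hf : ∀ x, HasDerivAt f (f' x) x)
    (hK : ∀ x y, |f' x - f' y| ≤ K * |x - y|) (x y : ℝ) :
    |f y - f x - f' x * (y - x)| ≤ K * (y - x) ^ 2 := by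
  have h := (convex_uIcc x y).norm_image_sub_le_of_norm_hasDerivWithin_le (C := K * |y - x|)
    (f := fun z => f z - f' x * z) (f' := fun z => f' z - f' x) (x := x) (y := y)
    (fun z _ => by
      have h := ((hf z).sub ((hasDerivAt_id z).const_mul (f' x))).hasDerivWithinAt
        (s := Set.uIcc x y)
      rw [mul_one] at h
      exact h)
    (fun z hz => by
      rw [Real.norm_eq_abs]
      refine (hK z x).trans ?_
      have hK0 : 0 ≤ K := by
        have := (abs_nonneg _).trans (hK 1 0)
        simpa using this
      exact mul_le_mul_of_nonneg_left (Set.abs_sub_left_of_mem_uIcc hz) hK0)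
    Set.left_mem_uIcc Set.right_mem_uIcc
  rw [Real.norm_eq_abs, Real.norm_eq_abs] at h
  calc _ = |f y - f' x * y - (f x - f' x * x)| := by congr 1; ring
    _ ≤ K * |y - x| * |y - x| := h
    _ = _ := by rw [mul_assoc, ← sq, sq_abs]

/-- Along each coordinate a linear spectral statistic is differentiable: by the second-order Taylor
estimate its increment differs from the linear one by a quadratic error. -/
theorem hasDerivAt_linStat_update {f f' : ℝ → ℝ} {K : ℝ} (hf : ∀ x, HasDerivAt f (f' x) x)
    (hK : ∀ x y, |f' x - f' y| ≤ K * |x - y|) (a : UpperIndex n → ℝ) (p : UpperIndex n) (s : ℝ) :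
    HasDerivAt (fun t => linStat f (Function.update a p t))
      (linStatGrad f' p (Function.update a p s)) s := by
  set E := wignerMatrix (Pi.single p (1 : ℝ)) with hE
  have hbound : ∀ t, |linStat f (Function.update a p t) - linStat f (Function.update a p s)
      - (t - s) * linStatGrad f' p (Function.update a p s)| ≤ (K * hsSq E / n) * (t - s) ^ 2 := by
    intro t
    have h := abs_trace_taylor_le (wignerMatrix_isHermitian (Function.update a p t))
      (wignerMatrix_isHermitian (Function.update a p s)) (taylor_of_lipschitz_deriv hf hK)
    rw [wignerMatrix_update_sub, ← hE, Matrix.mul_smul, Matrix.trace_smul, smul_eq_mul] at h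
    have hh : hsSq ((t - s) • E) = (t - s) ^ 2 * hsSq E := by
      simp only [hsSq, Matrix.smul_apply, smul_eq_mul, mul_pow, Finset.mul_sum]
    rw [hh] at h
    have h2 := div_le_div_of_nonneg_right h (Nat.cast_nonneg (α := ℝ) n)
    rw [← Nat.abs_cast n, ← abs_div, Nat.abs_cast] at h2
    calc _ = _ := by
          congr 1
          rw [linStat, linStat, linStatGrad, sub_div, sub_div, mul_div_assoc]
      _ ≤ _ := h2
      _ = _ := by ring
  rw [hasDerivAt_iff_isLittleO]
  have hO : (fun t => linStat f (Function.update a p t) - linStat f (Function.update a p s)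
      - (t - s) • linStatGrad f' p (Function.update a p s)) =O[nhds s] fun t => (t - s) ^ 2 := by
    refine Asymptotics.IsBigO.of_bound (K * hsSq E / n) (Filter.Eventually.of_forall fun t => ?_)
    rw [Real.norm_eq_abs, Real.norm_eq_abs, abs_of_nonneg (sq_nonneg (t - s)), smul_eq_mul]
    exact hbound t
  refine hO.trans_isLittleO ?_
  have h1 : (fun t : ℝ => (t - s) ^ 2) =o[nhds s] fun t => t - s := by
    have h2 : (fun t : ℝ => t - s) =o[nhds s] fun _ => (1 : ℝ) := by
      rw [Asymptotics.isLittleO_one_iff]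
      have : Continuous fun t : ℝ => t - s := by fun_prop
      simpa using this.tendsto s
    simpa [sq] using h2.mul_isBigO (Asymptotics.isBigO_refl (fun t : ℝ => t - s) (nhds s))
  exact h1

theorem linStat_mono {f g : ℝ → ℝ} (h : ∀ x, f x ≤ g x) (a : UpperIndex n → ℝ) :
    linStat f a ≤ linStat g a :=
  div_le_div_of_nonneg_right (Finset.sum_le_sum fun _ _ => h _) (Nat.cast_nonneg n)

theorem linStat_const (hn : n ≠ 0) (c : ℝ) (a : UpperIndex n → ℝ) :
    linStat (fun _ => c) a = c := by
  have : (n : ℝ) ≠ 0 := by exact_mod_cast hn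
  simp [linStat, this]

theorem linStat_add (f g : ℝ → ℝ) (a : UpperIndex n → ℝ) :
    linStat (fun x => f x + g x) a = linStat f a + linStat g a := by
  simp [linStat, Finset.sum_add_distrib, add_div]

theorem linStat_const_mul (c : ℝ) (f : ℝ → ℝ) (a : UpperIndex n → ℝ) :
    linStat (fun x => c * f x) a = c * linStat f a := by
  simp [linStat, ← Finset.mul_sum, mul_div_assoc]

theorem linStat_neg (f : ℝ → ℝ) (a : UpperIndex n → ℝ) :
    linStat (fun x => - f x) a = - linStat f a := by
  simp [linStat, neg_div]

theorem abs_linStat_le {f : ℝ → ℝ} {K : ℝ} (hK : 0 ≤ K) (h : ∀ x, |f x| ≤ K)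
    (a : UpperIndex n → ℝ) : |linStat f a| ≤ K := by
  rcases eq_or_ne n 0 with rfl | hn
  · simpa [linStat] using hK
  · rw [abs_le]
    constructor
    · rw [← linStat_const hn (-K) a]
      exact linStat_mono (fun x => (abs_le.1 (h x)).1) a
    · conv_rhs => rw [← linStat_const hn K a]
      exact linStat_mono (fun x => (abs_le.1 (h x)).2) a

theorem spectralCDF_eq_linStat (a : UpperIndex n → ℝ) (x : ℝ) :
    spectralCDF a x = linStat (fun y => if y ≤ x then 1 else 0) a := by
  simp [spectralCDF, empiricalCDF, linStat]

theorem linStat_sq (a : UpperIndex n → ℝ) :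
    linStat (fun y => y ^ 2) a =
      (∑ j, ∑ k, a ⟨(min j k, max j k), min_le_max⟩ ^ 2) / (n : ℝ) ^ 2 := by
  rw [linStat, ← hsSq_specFun _ (fun x => x), specFun_id, hsSq_wignerMatrix_eq, div_div, ← sq]

end Wigner

/-! ### Functional inequalities for `C¹` functions -/

section Approximation

open Filter Topology

/-- A bounded `C¹` function with bounded derivative is a pointwise limit of smooth functions obeying
the same bounds, with pointwise convergence of the derivatives. -/
theorem exists_smooth_approx {g g' : ℝ → ℝ} {K L : ℝ} (hg : ∀ x, HasDerivAt g (g' x) x)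
    (hg' : Continuous g') (hK : ∀ x, |g x| ≤ K) (hL : ∀ x, |g' x| ≤ L) :
    ∃ G : ℕ → ℝ → ℝ, (∀ k, ContDiff ℝ (⊤ : ℕ∞) (G k)) ∧ (∀ k x, |G k x| ≤ K) ∧
      (∀ k x, |deriv (G k) x| ≤ L) ∧ (∀ x, Tendsto (fun k => G k x) atTop (𝓝 (g x))) ∧
      (∀ x, Tendsto (fun k => deriv (G k) x) atTop (𝓝 (g' x))) := by
  have hgc : Continuous g := continuous_iff_continuousAt.2 fun x => (hg x).continuousAt
  let φ : ℕ → ContDiffBump (0 : ℝ) := fun k =>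
    ⟨1 / (2 * ((k : ℝ) + 1)), 1 / ((k : ℝ) + 1), by positivity, by
      apply one_div_lt_one_div_of_lt <;> [positivity; linarith [(Nat.cast_nonneg k : (0 : ℝ) ≤ k)]]⟩
  let ρ : ℕ → ℝ → ℝ := fun k => (φ k).normed volume
  have hρ0 : ∀ k t, 0 ≤ ρ k t := fun k t => (φ k).nonneg_normed t
  have hρ1 : ∀ k, ∫ t, ρ k t = 1 := fun k => (φ k).integral_normed
  have hρi : ∀ k, Integrable (ρ k) := fun k => (φ k).integrable_normed
  have hρc : ∀ k, Continuous (ρ k) := fun k => (φ k).continuous_normed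
  have hr : Tendsto (fun k => (φ k).rOut) atTop (𝓝 0) := tendsto_one_div_add_atTop_nhds_zero_nat
  have hbound : ∀ (k : ℕ) (f : ℝ → ℝ) (M : ℝ), (∀ x, |f x| ≤ M) → ∀ x,
      |∫ t, ρ k t * f (x - t)| ≤ M := by
    intro k f M hM x
    have h := norm_integral_le_of_norm_le (f := fun t => ρ k t * f (x - t))
      (g := fun t => ρ k t * M) ((hρi k).mul_const M) (Eventually.of_forall fun t => by
        rw [Real.norm_eq_abs, abs_mul, abs_of_nonneg (hρ0 k t)]
        exact mul_le_mul_of_nonneg_left (hM _) (hρ0 k t))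
    rwa [integral_mul_const, hρ1, one_mul] at h
  have hconv : ∀ (f : ℝ → ℝ) (k : ℕ), convolution (ρ k) f (ContinuousLinearMap.lsmul ℝ ℝ) volume =
      fun x => ∫ t, ρ k t * f (x - t) := by
    intro f k; ext x; simp [convolution_def]
  have hlim : ∀ f : ℝ → ℝ, Continuous f → ∀ x,
      Tendsto (fun k => ∫ t, ρ k t * f (x - t)) atTop (𝓝 (f x)) := by
    intro f hf x
    have h := ContDiffBump.convolution_tendsto_right_of_continuous (μ := volume) hr hf x
    refine h.congr fun k => ?_
    exact congrFun (hconv f k) x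
  have hderiv : ∀ k x, HasDerivAt (fun x => ∫ t, ρ k t * g (x - t))
      (∫ t, ρ k t * g' (x - t)) x := by
    intro k x
    refine (hasDerivAt_integral_of_dominated_loc_of_deriv_le (F := fun x t => ρ k t * g (x - t))
      (F' := fun x t => ρ k t * g' (x - t)) (bound := fun t => ρ k t * L) (s := Set.univ)
      Filter.univ_mem ?_ ?_ ?_ ?_ ?_ ?_).2
    · exact Eventually.of_forall fun x => ((hρc k).mul (hgc.comp (by fun_prop))).aestronglyMeasurable
    · refine Integrable.mono' ((hρi k).mul_const K)
        ((hρc k).mul (hgc.comp (by fun_prop))).aestronglyMeasurable (Eventually.of_forall fun t => ?_)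
      rw [Real.norm_eq_abs, abs_mul, abs_of_nonneg (hρ0 k t)]
      exact mul_le_mul_of_nonneg_left (hK _) (hρ0 k t)
    · exact ((hρc k).mul (hg'.comp (by fun_prop))).aestronglyMeasurable
    · refine Eventually.of_forall fun t y _ => ?_
      rw [Real.norm_eq_abs, abs_mul, abs_of_nonneg (hρ0 k t)]
      exact mul_le_mul_of_nonneg_left (hL _) (hρ0 k t)
    · exact (hρi k).mul_const L
    · refine Eventually.of_forall fun t y _ => ?_
      have := (hg (y - t)).comp_sub_const y t
      exact this.const_mul _
  refine ⟨fun k x => ∫ t, ρ k t * g (x - t), fun k => ?_, fun k => hbound k g K hK, fun k x => ?_,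
    hlim g hgc, fun x => ?_⟩
  · have h := (φ k).hasCompactSupport_normed.contDiff_convolution_left (μ := volume)
      (ContinuousLinearMap.lsmul ℝ ℝ) ((φ k).contDiff_normed (n := (⊤ : ℕ∞)) (μ := volume))
      hgc.locallyIntegrable
    rw [hconv g k] at h
    exact h
  · rw [(hderiv k x).deriv]; exact hbound k g' L hL x
  · refine (hlim g' hg' x).congr fun k => ((hderiv k x).deriv).symm

theorem tendsto_integral_of_bounded {μ : Measure ℝ} [IsProbabilityMeasure μ] {f : ℕ → ℝ → ℝ}
    {F : ℝ → ℝ} {C : ℝ} (hf : ∀ k, Continuous (f k)) (hC : ∀ k x, |f k x| ≤ C)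
    (h : ∀ x, Tendsto (fun k => f k x) atTop (𝓝 (F x))) :
    Tendsto (fun k => ∫ x, f k x ∂μ) atTop (𝓝 (∫ x, F x ∂μ)) :=
  tendsto_integral_of_dominated_convergence (fun _ => C) (fun k => (hf k).aestronglyMeasurable)
    (integrable_const C) (fun k => Eventually.of_forall fun x => hC k x) (Eventually.of_forall h)

theorem integrable_of_bounded {α : Type*} [MeasurableSpace α] {μ : Measure α} [IsFiniteMeasure μ]
    {f : α → ℝ} {C : ℝ} (hf : Measurable f) (hC : ∀ x, |f x| ≤ C) : Integrable f μ :=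
  Integrable.of_bound hf.aestronglyMeasurable C (Eventually.of_forall hC)

theorem PoincareInequality.of_hasDerivAt {μ : Measure ℝ} [IsProbabilityMeasure μ] {c : ℝ}
    (h : PoincareInequality μ c) {g g' : ℝ → ℝ} {K L : ℝ} (hg : ∀ x, HasDerivAt g (g' x) x)
    (hg' : Continuous g') (hK : ∀ x, |g x| ≤ K) (hL : ∀ x, |g' x| ≤ L) :
    (∫ x, (g x) ^ 2 ∂μ) - (∫ x, g x ∂μ) ^ 2 ≤ c * ∫ x, (g' x) ^ 2 ∂μ := by
  obtain ⟨G, hG, hGK, hGL, hGg, hGg'⟩ := exists_smooth_approx hg hg' hK hL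
  have hGc : ∀ k, Continuous (G k) := fun k => (hG k).continuous
  have hGd : ∀ k, Continuous (deriv (G k)) := fun k => (hG k).continuous_deriv (by simp)
  have hsq : ∀ {x M : ℝ}, |x| ≤ M → |x ^ 2| ≤ M ^ 2 := fun h => by
    rw [abs_pow]; exact pow_le_pow_left₀ (abs_nonneg _) h 2
  refine le_of_tendsto_of_tendsto' ((tendsto_integral_of_bounded (C := K ^ 2)
    (fun k => (hGc k).pow 2) (fun k x => hsq (hGK k x)) (fun x => (hGg x).pow 2)).sub
    ((tendsto_integral_of_bounded hGc hGK hGg).pow 2))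
    ((tendsto_integral_of_bounded (C := L ^ 2) (fun k => (hGd k).pow 2)
    (fun k x => hsq (hGL k x)) (fun x => (hGg' x).pow 2)).const_mul c) fun k => ?_
  exact h (G k) (hG k) ⟨K, hGK k⟩
    (integrable_of_bounded ((hGd k).pow 2).measurable fun x => hsq (hGL k x))

theorem LogSobolevInequality.of_hasDerivAt {μ : Measure ℝ} [IsProbabilityMeasure μ] {c : ℝ}
    (h : LogSobolevInequality μ c) {g g' : ℝ → ℝ} {K L : ℝ} (hg : ∀ x, HasDerivAt g (g' x) x)
    (hg' : Continuous g') (hK : ∀ x, |g x| ≤ K) (hL : ∀ x, |g' x| ≤ L) :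
    entropyFunctional μ (fun x => (g x) ^ 2) ≤ 2 * c * ∫ x, (g' x) ^ 2 ∂μ := by
  obtain ⟨G, hG, hGK, hGL, hGg, hGg'⟩ := exists_smooth_approx hg hg' hK hL
  have hGc : ∀ k, Continuous (G k) := fun k => (hG k).continuous
  have hGd : ∀ k, Continuous (deriv (G k)) := fun k => (hG k).continuous_deriv (by simp)
  have hsq : ∀ {x M : ℝ}, |x| ≤ M → |x ^ 2| ≤ M ^ 2 := fun h => by
    rw [abs_pow]; exact pow_le_pow_left₀ (abs_nonneg _) h 2
  obtain ⟨M, hM⟩ := (isCompact_Icc (a := 0) (b := K ^ 2)).exists_bound_of_continuousOn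
    (f := fun y : ℝ => y * Real.log y) Real.continuous_mul_log.continuousOn
  have hml : ∀ k x, |G k x ^ 2 * Real.log (G k x ^ 2)| ≤ M := fun k x =>
    hM _ ⟨sq_nonneg _, (abs_le.1 (hsq (hGK k x))).2⟩
  have hi : Tendsto (fun k => ∫ x, G k x ^ 2 ∂μ) atTop (𝓝 (∫ x, g x ^ 2 ∂μ)) :=
    tendsto_integral_of_bounded (C := K ^ 2) (fun k => (hGc k).pow 2)
      (fun k x => hsq (hGK k x)) (fun x => (hGg x).pow 2)
  refine le_of_tendsto_of_tendsto' ((tendsto_integral_of_bounded (C := M)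
    (f := fun k x => G k x ^ 2 * Real.log (G k x ^ 2))
    (fun k => Real.continuous_mul_log.comp ((hGc k).pow 2)) hml
    (fun x => (Real.continuous_mul_log.tendsto _).comp ((hGg x).pow 2))).sub
    ((Real.continuous_mul_log.tendsto _).comp hi))
    ((tendsto_integral_of_bounded (C := L ^ 2) (fun k => (hGd k).pow 2)
    (fun k x => hsq (hGL k x)) (fun x => (hGg' x).pow 2)).const_mul (2 * c)) fun k => ?_
  exact h (G k) (hG k) ⟨K, hGK k⟩
    (integrable_of_bounded ((hGd k).pow 2).measurable fun x => hsq (hGL k x))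

end Approximation

/-! ### Tensorization of variance and entropy -/

section Tensorization

open Filter Topology

/-- The `φ`-entropy `∫ φ(f) dμ - φ(∫ f dμ)`: the variance for `φ(x) = x²`, the entropy for
`φ(x) = x log x`. -/
def phiEntropy {α : Type*} [MeasurableSpace α] (φ : ℝ → ℝ) (μ : Measure α) (f : α → ℝ) : ℝ :=
  (∫ x, φ (f x) ∂μ) - φ (∫ x, f x ∂μ)

/-- The `φ`-entropy lies above its tangents on the functions with values in `[α, β]`; here `φ'` is
the derivative of `φ`. -/
def PhiEntropyConvex (φ φ' : ℝ → ℝ) (α β : ℝ) : Prop :=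
  ∀ (μ : Measure ℝ) [IsProbabilityMeasure μ] (F G : ℝ → ℝ), Measurable F → Measurable G →
    (∀ x, F x ∈ Set.Icc α β) → (∀ x, G x ∈ Set.Icc α β) →
    phiEntropy φ μ G + ∫ x, (φ' (G x) - φ' (∫ y, G y ∂μ)) * (F x - G x) ∂μ ≤ phiEntropy φ μ F

theorem abs_le_of_mem_Icc {α β x : ℝ} (h : x ∈ Set.Icc α β) : |x| ≤ max |α| |β| :=
  abs_le_max_abs_abs h.1 h.2

theorem integrable_of_mem_Icc {X : Type*} [MeasurableSpace X] {μ : Measure X} [IsFiniteMeasure μ]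
    {f : X → ℝ} {α β : ℝ} (hf : Measurable f) (h : ∀ x, f x ∈ Set.Icc α β) : Integrable f μ :=
  integrable_of_bounded hf fun x => abs_le_of_mem_Icc (h x)

theorem integral_mem_Icc {X : Type*} [MeasurableSpace X] {μ : Measure X} [IsProbabilityMeasure μ]
    {f : X → ℝ} {α β : ℝ} (hf : Measurable f) (h : ∀ x, f x ∈ Set.Icc α β) :
    ∫ x, f x ∂μ ∈ Set.Icc α β := by
  have hi := integrable_of_mem_Icc (μ := μ) hf h
  constructor
  · simpa using integral_mono (integrable_const α) hi fun x => (h x).1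
  · simpa using integral_mono hi (integrable_const β) fun x => (h x).2

theorem phiEntropyConvex_sq (α β : ℝ) :
    PhiEntropyConvex (fun x => x ^ 2) (fun x => 2 * x) α β := by
  intro μ _ F G hF hG hFI hGI
  have iF := integrable_of_mem_Icc (μ := μ) hF hFI
  have iG := integrable_of_mem_Icc (μ := μ) hG hGI
  have bF := fun x => abs_le_of_mem_Icc (hFI x)
  have bG := fun x => abs_le_of_mem_Icc (hGI x)
  set M := max |α| |β|
  have hM : 0 ≤ M := (abs_nonneg _).trans (bF 0)
  have hprod : ∀ {U V : ℝ → ℝ}, Measurable U → Measurable V → (∀ x, |U x| ≤ M) →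
      (∀ x, |V x| ≤ M) → Integrable (fun x => U x * V x) μ := fun hU hV bU bV =>
    integrable_of_bounded (C := M * M) (hU.mul hV) fun x => by
      rw [abs_mul]; exact mul_le_mul (bU x) (bV x) (abs_nonneg _) hM
  have iFF := hprod hF hF bF bF
  have iFG := hprod hF hG bF bG
  have iGG := hprod hG hG bG bG
  have hv : 0 ≤ ∫ x, ((F x - ∫ y, F y ∂μ) - (G x - ∫ y, G y ∂μ)) ^ 2 ∂μ :=
    integral_nonneg fun x => sq_nonneg _
  set a := ∫ y, F y ∂μ
  set b := ∫ y, G y ∂μ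
  have e1 : ∫ x, ((F x - a) - (G x - b)) ^ 2 ∂μ =
      ∫ x, F x * F x ∂μ + ∫ x, G x * G x ∂μ - 2 * ∫ x, F x * G x ∂μ - (a - b) ^ 2 := by
    have : ∀ x, ((F x - a) - (G x - b)) ^ 2 = F x * F x + G x * G x - 2 * (F x * G x)
        - 2 * (a - b) * F x + 2 * (a - b) * G x + (a - b) ^ 2 := fun x => by ring
    simp_rw [this]
    rw [integral_add (by fun_prop) (by fun_prop), integral_add (by fun_prop) (by fun_prop),
      integral_sub (by fun_prop) (by fun_prop), integral_sub (by fun_prop) (by fun_prop),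
      integral_add (by fun_prop) (by fun_prop), integral_const_mul, integral_const_mul,
      integral_const_mul]
    simp only [integral_const, probReal_univ, one_smul]
    change _ - 2 * (a - b) * a + 2 * (a - b) * b + _ = _
    ring
  have e2 : ∫ x, (2 * G x - 2 * b) * (F x - G x) ∂μ =
      2 * ∫ x, F x * G x ∂μ - 2 * ∫ x, G x * G x ∂μ - 2 * b * (a - b) := by
    have : ∀ x, (2 * G x - 2 * b) * (F x - G x) = 2 * (F x * G x) - 2 * (G x * G x)
        - 2 * b * F x + 2 * b * G x := fun x => by ring
    simp_rw [this]
    rw [integral_add (by fun_prop) (by fun_prop), integral_sub (by fun_prop) (by fun_prop),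
      integral_sub (by fun_prop) (by fun_prop), integral_const_mul, integral_const_mul,
      integral_const_mul, integral_const_mul]
    change _ - 2 * b * a + 2 * b * b = _
    ring
  simp only [phiEntropy]
  rw [e2]
  simp only [sq] at *
  change _ - b * b + _ ≤ _ - a * a
  nlinarith

theorem phiEntropyConvex_mul_log {α β : ℝ} (hα : 0 < α) :
    PhiEntropyConvex (fun x => x * Real.log x) (fun x => Real.log x + 1) α β := by
  intro μ _ F G hF hG hFI hGI
  have iF := integrable_of_mem_Icc (μ := μ) hF hFI
  have iG := integrable_of_mem_Icc (μ := μ) hG hGI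
  have ha : 0 < ∫ x, F x ∂μ := hα.trans_le (integral_mem_Icc hF hFI).1
  have hb : 0 < ∫ x, G x ∂μ := hα.trans_le (integral_mem_Icc hG hGI).1
  set a := ∫ y, F y ∂μ with ha'
  set b := ∫ y, G y ∂μ with hb'
  have pF : ∀ x, 0 < F x := fun x => hα.trans_le (hFI x).1
  have pG : ∀ x, 0 < G x := fun x => hα.trans_le (hGI x).1
  have hlog : ∀ {U : ℝ → ℝ}, Measurable U → (∀ x, U x ∈ Set.Icc α β) →
      (Measurable fun x => Real.log (U x)) ∧
        ∀ x, Real.log (U x) ∈ Set.Icc (Real.log α) (Real.log β) := fun hU hUI =>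
    ⟨Real.measurable_log.comp hU, fun x => ⟨Real.log_le_log hα (hUI x).1,
      Real.log_le_log (hα.trans_le (hUI x).1) (hUI x).2⟩⟩
  have hprod : ∀ {U V : ℝ → ℝ}, Measurable U → Measurable V → (∀ x, U x ∈ Set.Icc α β) →
      (∀ x, V x ∈ Set.Icc α β) → Integrable (fun x => U x * Real.log (V x)) μ :=
    fun hU hV bU bV => by
      obtain ⟨h1, h2⟩ := hlog hV bV
      refine integrable_of_bounded (C := max |α| |β| * max |Real.log α| |Real.log β|)
        (hU.mul h1) fun x => ?_
      rw [abs_mul]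
      exact mul_le_mul (abs_le_of_mem_Icc (bU x)) (abs_le_of_mem_Icc (h2 x)) (abs_nonneg _)
        ((abs_nonneg _).trans (le_max_left _ _))
  have iFF := hprod hF hF hFI hFI
  have iFG := hprod hF hG hFI hGI
  have iGG := hprod hG hG hGI hGI
  have e2 : ∫ x, (Real.log (G x) + 1 - (Real.log b + 1)) * (F x - G x) ∂μ =
      ∫ x, F x * Real.log (G x) ∂μ - ∫ x, G x * Real.log (G x) ∂μ - Real.log b * (a - b) := by
    have : ∀ x, (Real.log (G x) + 1 - (Real.log b + 1)) * (F x - G x) =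
        F x * Real.log (G x) - G x * Real.log (G x) - Real.log b * F x + Real.log b * G x :=
      fun x => by ring
    simp_rw [this]
    rw [integral_add (by fun_prop) (by fun_prop), integral_sub (by fun_prop) (by fun_prop),
      integral_sub (by fun_prop) (by fun_prop), integral_const_mul, integral_const_mul, ← ha', ← hb']
    ring
  -- `log z ≥ 1 - 1/z` at `z = F b / (G a)`; the right-hand side integrates to zero.
  have key : ∀ x, F x - a / b * G x ≤
      F x * Real.log (F x) - F x * Real.log (G x) + F x * Real.log b - F x * Real.log a := by
    intro x
    have h := Real.one_sub_inv_le_log_of_pos (show 0 < F x * b / (G x * a) by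
      have := pF x; have := pG x; positivity)
    rw [Real.log_div (mul_ne_zero (pF x).ne' hb.ne') (mul_ne_zero (pG x).ne' ha.ne'),
      Real.log_mul (pF x).ne' hb.ne', Real.log_mul (pG x).ne' ha.ne'] at h
    have h2 := mul_le_mul_of_nonneg_left h (pF x).le
    have h3 : F x * (1 - (F x * b / (G x * a))⁻¹) = F x - a / b * G x := by
      have := (pF x).ne'; have := (pG x).ne'
      field_simp
    linarith
  have hint := integral_mono (μ := μ) (by fun_prop) (by fun_prop) key
  rw [integral_sub (by fun_prop) (by fun_prop), integral_const_mul,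
    integral_sub (by fun_prop) (by fun_prop), integral_add (by fun_prop) (by fun_prop),
    integral_sub (by fun_prop) (by fun_prop), integral_mul_const, integral_mul_const, ← ha', ← hb',
    div_mul_cancel₀ _ hb.ne'] at hint
  simp only [phiEntropy]
  rw [e2, ← ha', ← hb']
  linarith

variable {φ φ' : ℝ → ℝ} {α β : ℝ}

/-- Passing to the partial average in the second variable decreases the `φ`-entropy in the first. -/
theorem phiEntropy_integral_le {Y : Type*} [MeasurableSpace Y] (hφ : Continuous φ)
    (hφ' : Measurable φ') (hb : ∃ M, ∀ x ∈ Set.Icc α β, |φ' x| ≤ M)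
    (hconv : PhiEntropyConvex φ φ' α β) (μ : Measure ℝ) [IsProbabilityMeasure μ] (ν : Measure Y)
    [IsProbabilityMeasure ν] {f : ℝ × Y → ℝ} (hf : Measurable f) (hI : ∀ z, f z ∈ Set.Icc α β) :
    phiEntropy φ μ (fun x => ∫ y, f (x, y) ∂ν) ≤ ∫ y, phiEntropy φ μ (fun x => f (x, y)) ∂ν := by
  obtain ⟨M, hM⟩ := hb
  obtain ⟨Mφ, hMφ⟩ := (isCompact_Icc (a := α) (b := β)).exists_bound_of_continuousOn
    hφ.continuousOn
  set g : ℝ → ℝ := fun x => ∫ y, f (x, y) ∂ν with hg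
  have hfi : Integrable f (μ.prod ν) := integrable_of_mem_Icc hf hI
  have hgm : Measurable g := hf.stronglyMeasurable.integral_prod_right'.measurable
  have hgI : ∀ x, g x ∈ Set.Icc α β := fun x =>
    integral_mem_Icc (hf.comp (by fun_prop)) fun y => hI _
  have hgi : ∫ x, g x ∂μ ∈ Set.Icc α β := integral_mem_Icc hgm hgI
  set b := ∫ x, g x ∂μ
  let K : ℝ × Y → ℝ := fun z => (φ' (g z.1) - φ' b) * (f z - g z.1)
  have hK : Measurable K := by
    have h1 : Measurable fun z : ℝ × Y => g z.1 := hgm.comp measurable_fst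
    exact ((hφ'.comp h1).sub_const _).mul (hf.sub h1)
  have hKi : Integrable K (μ.prod ν) := by
    refine integrable_of_bounded (C := (M + M) * (max |α| |β| + max |α| |β|)) hK fun z => ?_
    have hM0 : 0 ≤ M := (abs_nonneg _).trans (hM _ hgi)
    rw [abs_mul]
    refine mul_le_mul ((abs_sub _ _).trans (add_le_add (hM _ (hgI _)) (hM _ hgi)))
      ((abs_sub _ _).trans (add_le_add (abs_le_of_mem_Icc (hI _)) (abs_le_of_mem_Icc (hgI _))))
      (abs_nonneg _) (by positivity)
  have hφfi : Integrable (fun z => φ (f z)) (μ.prod ν) :=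
    integrable_of_bounded (hφ.measurable.comp hf) fun z => hMφ _ (hI z)
  have hH : Integrable (fun y => phiEntropy φ μ fun x => f (x, y)) ν := by
    refine (hφfi.integral_prod_right).sub ?_
    have hm : Measurable fun y => ∫ x, f (x, y) ∂μ := hf.stronglyMeasurable.integral_prod_left'.measurable
    exact integrable_of_bounded (hφ.measurable.comp hm) fun y => hMφ _
      (integral_mem_Icc (hf.comp (by fun_prop)) fun x => hI _)
  have hle : ∀ y, phiEntropy φ μ g + ∫ x, K (x, y) ∂μ ≤ phiEntropy φ μ (fun x => f (x, y)) :=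
    fun y => hconv μ (fun x => f (x, y)) g (hf.comp (by fun_prop)) hgm (fun x => hI _) hgI
  have hint := integral_mono ((integrable_const _).add hKi.integral_prod_right) hH hle
  have hzero : ∫ y, ∫ x, K (x, y) ∂μ ∂ν = 0 := by
    rw [← integral_prod_symm K hKi, integral_prod K hKi]
    have : ∀ x, ∫ y, K (x, y) ∂ν = 0 := fun x => by
      have hi : Integrable (fun y => f (x, y)) ν :=
        integrable_of_mem_Icc (hf.comp (by fun_prop)) fun y => hI _
      simp only [K]
      rw [integral_const_mul, integral_sub hi (integrable_const _)]
      simp [hg]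
    simp [this]
  have e : ∫ y, (phiEntropy φ μ g + ∫ x, K (x, y) ∂μ) ∂ν = phiEntropy φ μ g := by
    rw [integral_add (integrable_const _) hKi.integral_prod_right, hzero]; simp
  exact e.symm.le.trans hint

theorem integral_pi_fin_succ {m : ℕ} (μ : Fin (m + 1) → Measure ℝ) [∀ i, IsProbabilityMeasure (μ i)]
    (F : (Fin (m + 1) → ℝ) → ℝ) :
    ∫ a, F a ∂Measure.pi μ =
      ∫ z : ℝ × (Fin m → ℝ), F (Fin.cons z.1 z.2)
        ∂(μ 0).prod (Measure.pi fun i : Fin m => μ i.succ) := by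
  have h := (measurePreserving_piFinSuccAbove μ 0).symm
  rw [← h.integral_comp']
  simp only [MeasurableEquiv.piFinSuccAbove_symm_apply, Fin.insertNthEquiv, Fin.insertNth_zero]
  rfl

/-- Tensorization: the `φ`-entropy of a product measure is at most the sum of the mean `φ`-entropies in
the single coordinates. These enter only through upper bounds `∫ Rᵢ dμᵢ`, which is the form in which a
functional inequality for `μᵢ` supplies them. -/
theorem phiEntropy_pi_fin_le (hφ : Continuous φ)
    (hφ' : Measurable φ') (hb : ∃ M, ∀ x ∈ Set.Icc α β, |φ' x| ≤ M)
    (hconv : PhiEntropyConvex φ φ' α β) {m : ℕ} (μ : Fin m → Measure ℝ)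
    [∀ i, IsProbabilityMeasure (μ i)] {f : (Fin m → ℝ) → ℝ} (hf : Measurable f)
    (hI : ∀ z, f z ∈ Set.Icc α β) {R : Fin m → (Fin m → ℝ) → ℝ} {C : ℝ} (hR : ∀ i, Measurable (R i))
    (hRC : ∀ i a, |R i a| ≤ C)
    (h : ∀ i a, phiEntropy φ (μ i) (fun t => f (Function.update a i t)) ≤
      ∫ t, R i (Function.update a i t) ∂μ i) :
    phiEntropy φ (Measure.pi μ) f ≤ ∑ i, ∫ a, R i a ∂Measure.pi μ := by
  induction m with
  | zero =>
    have : ∀ a, f a = f default := fun a => congrArg f (Subsingleton.elim _ _)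
    simp [phiEntropy, this]
  | succ m ih =>
    obtain ⟨Mφ, hMφ⟩ := (isCompact_Icc (a := α) (b := β)).exists_bound_of_continuousOn
      hφ.continuousOn
    set ν := Measure.pi fun i : Fin m => μ i.succ with hν
    have hcons : Measurable fun z : ℝ × (Fin m → ℝ) => (Fin.cons z.1 z.2 : Fin (m + 1) → ℝ) := by
      rw [measurable_pi_iff]
      intro i
      refine Fin.cases ?_ (fun j => ?_) i
      · simpa using measurable_fst
      · exact (measurable_pi_apply j).comp measurable_snd
    set f₂ : ℝ × (Fin m → ℝ) → ℝ := fun z => f (Fin.cons z.1 z.2) with hf₂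
    have hf₂m : Measurable f₂ := hf.comp hcons
    have hfi : Integrable f₂ ((μ 0).prod ν) := integrable_of_mem_Icc hf₂m fun z => hI _
    have hφi : Integrable (fun z => φ (f₂ z)) ((μ 0).prod ν) :=
      integrable_of_bounded (hφ.measurable.comp hf₂m) fun z => hMφ _ (hI _)
    have hRi : ∀ i, Integrable (fun z : ℝ × (Fin m → ℝ) => R i (Fin.cons z.1 z.2)) ((μ 0).prod ν) :=
      fun i => integrable_of_bounded ((hR i).comp hcons) fun z => hRC _ _
    set g : ℝ → ℝ := fun x => ∫ y, f₂ (x, y) ∂ν with hg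
    have hgm : Measurable g := hf₂m.stronglyMeasurable.integral_prod_right'.measurable
    have hgI : ∀ x, g x ∈ Set.Icc α β := fun x =>
      integral_mem_Icc (hf₂m.comp (by fun_prop)) fun y => hI _
    have hφg : Integrable (fun x => φ (g x)) (μ 0) :=
      integrable_of_bounded (hφ.measurable.comp hgm) fun x => hMφ _ (hgI x)
    have hdec : phiEntropy φ (Measure.pi μ) f =
        ∫ x, phiEntropy φ ν (fun y => f₂ (x, y)) ∂μ 0 + phiEntropy φ (μ 0) g := by
      simp only [phiEntropy]
      rw [integral_pi_fin_succ, integral_pi_fin_succ, integral_prod _ hφi, integral_prod _ hfi,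
        integral_sub hφi.integral_prod_left hφg]
      ring
    have h1 : ∀ x, phiEntropy φ ν (fun y => f₂ (x, y)) ≤
        ∑ i : Fin m, ∫ y, R i.succ (Fin.cons x y) ∂ν := by
      intro x
      refine ih (fun i => μ i.succ) (f := fun y => f₂ (x, y))
        (R := fun i y => R i.succ (Fin.cons x y)) (hf₂m.comp (by fun_prop)) (fun y => hI _)
        (fun i => (hR _).comp (hcons.comp measurable_prodMk_left)) (fun i y => hRC _ _) fun i y => ?_
      have := h i.succ (Fin.cons x y)
      simp only [← Fin.cons_update] at this
      exact this
    have h2 : phiEntropy φ (μ 0) g ≤ ∫ y, ∫ x, R 0 (Fin.cons x y) ∂μ 0 ∂ν := by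
      refine (phiEntropy_integral_le hφ hφ' hb hconv (μ 0) ν hf₂m fun z => hI _).trans ?_
      refine integral_mono ?_ (hRi 0).integral_prod_right fun y => ?_
      · refine (hφi.integral_prod_right).sub ?_
        have hm : Measurable fun y => ∫ x, f₂ (x, y) ∂μ 0 :=
          hf₂m.stronglyMeasurable.integral_prod_left'.measurable
        exact integrable_of_bounded (hφ.measurable.comp hm) fun y => hMφ _
          (integral_mem_Icc (hf₂m.comp (by fun_prop)) fun x => hI _)
      · have := h 0 (Fin.cons 0 y)
        simp only [Fin.update_cons_zero] at this
        exact this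
    rw [hdec, Fin.sum_univ_succ, add_comm]
    refine add_le_add ?_ ?_
    · rw [integral_pi_fin_succ, integral_prod_symm _ (hRi 0)]
      exact h2
    · have h3 : ∀ i : Fin m, ∫ a, R i.succ a ∂Measure.pi μ =
          ∫ x, ∫ y, R i.succ (Fin.cons x y) ∂ν ∂μ 0 := fun i => by
        rw [integral_pi_fin_succ, integral_prod _ (hRi _)]
      simp_rw [h3]
      rw [← integral_finsetSum _ fun i _ => (hRi i.succ).integral_prod_left]
      refine integral_mono ?_ (integrable_finsetSum _ fun i _ => (hRi i.succ).integral_prod_left) h1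
      exact hφi.integral_prod_left.sub hφg

theorem phiEntropy_pi_le {ι : Type} [Fintype ι] [DecidableEq ι] (hφ : Continuous φ)
    (hφ' : Measurable φ') (hb : ∃ M, ∀ x ∈ Set.Icc α β, |φ' x| ≤ M)
    (hconv : PhiEntropyConvex φ φ' α β) (μ : ι → Measure ℝ)
    [∀ i, IsProbabilityMeasure (μ i)] {f : (ι → ℝ) → ℝ} (hf : Measurable f)
    (hI : ∀ z, f z ∈ Set.Icc α β) {R : ι → (ι → ℝ) → ℝ} {C : ℝ} (hR : ∀ i, Measurable (R i))
    (hRC : ∀ i a, |R i a| ≤ C)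
    (h : ∀ i a, phiEntropy φ (μ i) (fun t => f (Function.update a i t)) ≤
      ∫ t, R i (Function.update a i t) ∂μ i) :
    phiEntropy φ (Measure.pi μ) f ≤ ∑ i, ∫ a, R i a ∂Measure.pi μ := by
  let e : Fin (Fintype.card ι) ≃ ι := (Fintype.equivFin ι).symm
  have hp := measurePreserving_piCongrLeft (α := fun _ => ℝ) μ e
  have hE : ∀ F : (ι → ℝ) → ℝ, ∫ a, F a ∂Measure.pi μ =
      ∫ b, F (fun i => b (e.symm i)) ∂Measure.pi fun j => μ (e j) := by
    intro F
    rw [← hp.integral_comp']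
    congr 1
    ext b
    congr 1
    ext i
    obtain ⟨j, rfl⟩ := e.surjective i
    simp [MeasurableEquiv.piCongrLeft]
  have hm : Measurable fun b : Fin (Fintype.card ι) → ℝ => fun i => b (e.symm i) :=
    measurable_pi_iff.2 fun i => measurable_pi_apply _
  have hupd : ∀ (b : Fin (Fintype.card ι) → ℝ) j t,
      (fun i => Function.update b j t (e.symm i)) =
        Function.update (fun i => b (e.symm i)) (e j) t := by
    intro b j t
    ext i
    obtain ⟨k, rfl⟩ := e.surjective i
    by_cases hk : k = j
    · subst hk; simp
    · simp [hk]
  have := phiEntropy_pi_fin_le hφ hφ' hb hconv (fun j => μ (e j))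
    (f := fun b => f fun i => b (e.symm i)) (R := fun j b => R (e j) fun i => b (e.symm i))
    (hf.comp hm) (fun _ => hI _) (fun j => (hR _).comp hm) (fun _ _ => hRC _ _) fun j b => by
      simp only [hupd]
      exact h (e j) _
  rw [phiEntropy, hE, hE, ← e.sum_comp]
  simp_rw [hE]
  exact this

end Tensorization

/-! ### Concentration of linear spectral statistics -/

section Concentration

open Filter Topology

/-- The functions `f` whose linear statistics are used: `f` is bounded with bounded and Lipschitz
derivative `f'`. -/
structure IsTestFunction (f f' : ℝ → ℝ) : Prop where
  hasDerivAt : ∀ x, HasDerivAt f (f' x) x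
  bounded : ∃ K, ∀ x, |f x| ≤ K
  bounded_deriv : ∃ L, ∀ x, |f' x| ≤ L
  lipschitz_deriv : ∃ L, ∀ x y, |f' x - f' y| ≤ L * |x - y|

namespace IsTestFunction

variable {f f' : ℝ → ℝ}

theorem lipschitz (h : IsTestFunction f f') : ∃ L, ∀ x y, |f x - f y| ≤ L * |x - y| := by
  obtain ⟨L, hL⟩ := h.bounded_deriv
  refine ⟨L, fun x y => ?_⟩
  have := convex_univ.norm_image_sub_le_of_norm_hasDerivWithin_le (f := f) (f' := f')
    (fun x _ => (h.hasDerivAt x).hasDerivWithinAt) (fun x _ => hL x)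
    (Set.mem_univ y) (Set.mem_univ x)
  exact this

theorem lipschitz_sq (h : IsTestFunction f f') :
    ∃ L, ∀ x y, |f' x ^ 2 - f' y ^ 2| ≤ L * |x - y| := by
  obtain ⟨L, hL⟩ := h.bounded_deriv
  obtain ⟨M, hM⟩ := h.lipschitz_deriv
  have hL0 : 0 ≤ L := (abs_nonneg _).trans (hL 0)
  refine ⟨(L + L) * M, fun x y => ?_⟩
  calc |f' x ^ 2 - f' y ^ 2| = |f' x + f' y| * |f' x - f' y| := by rw [← abs_mul]; congr 1; ring
    _ ≤ (L + L) * (M * |x - y|) := mul_le_mul ((abs_add_le _ _).trans (add_le_add (hL x) (hL y)))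
        (hM x y) (abs_nonneg _) (by positivity)
    _ = _ := by ring

theorem continuous_linStat (h : IsTestFunction f f') {n : ℕ} : Continuous (linStat (n := n) f) :=
  let ⟨_, hL⟩ := h.lipschitz
  _root_.continuous_linStat hL

theorem continuous_linStat_deriv (h : IsTestFunction f f') {n : ℕ} :
    Continuous (linStat (n := n) f') :=
  let ⟨_, hL⟩ := h.lipschitz_deriv
  _root_.continuous_linStat hL

theorem continuous_linStat_sq (h : IsTestFunction f f') {n : ℕ} :
    Continuous (linStat (n := n) fun x => f' x ^ 2) :=
  let ⟨_, hL⟩ := h.lipschitz_sq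
  _root_.continuous_linStat hL

theorem continuous_linStatGrad (h : IsTestFunction f f') {n : ℕ} (p : UpperIndex n) :
    Continuous (linStatGrad f' p) :=
  let ⟨_, hL⟩ := h.lipschitz_deriv
  _root_.continuous_linStatGrad hL p

theorem exists_linStatGrad_le (h : IsTestFunction f f') (n : ℕ) :
    ∃ L, ∀ (p : UpperIndex n) a, |linStatGrad f' p a| ≤ L := by
  obtain ⟨L, hL⟩ := h.bounded_deriv
  refine ⟨√(2 / (n : ℝ) ^ 2 * L ^ 2), fun p a => Real.abs_le_sqrt ?_⟩
  refine (Finset.single_le_sum (f := fun p => linStatGrad f' p a ^ 2) (fun _ _ => sq_nonneg _)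
    (Finset.mem_univ p)).trans ((sum_linStatGrad_sq_le f' a).trans ?_)
  refine mul_le_mul_of_nonneg_left ((le_abs_self _).trans (abs_linStat_le (sq_nonneg L)
    (fun x => ?_) a)) (by positivity)
  rw [abs_pow]
  exact pow_le_pow_left₀ (abs_nonneg _) (hL x) 2

theorem comp_add_const (h : IsTestFunction f f') (c : ℝ) :
    IsTestFunction (fun x => f (x + c)) (fun x => f' (x + c)) where
  hasDerivAt x := (h.hasDerivAt (x + c)).comp_add_const x c
  bounded := let ⟨K, hK⟩ := h.bounded; ⟨K, fun _ => hK _⟩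
  bounded_deriv := let ⟨K, hK⟩ := h.bounded_deriv; ⟨K, fun _ => hK _⟩
  lipschitz_deriv := let ⟨K, hK⟩ := h.lipschitz_deriv
    ⟨K, fun x y => by simpa using hK (x + c) (y + c)⟩

theorem neg (h : IsTestFunction f f') : IsTestFunction (fun x => - f x) (fun x => - f' x) where
  hasDerivAt x := (h.hasDerivAt x).neg
  bounded := let ⟨K, hK⟩ := h.bounded; ⟨K, fun x => by simpa using hK x⟩
  bounded_deriv := let ⟨K, hK⟩ := h.bounded_deriv; ⟨K, fun x => by simpa using hK x⟩
  lipschitz_deriv := let ⟨K, hK⟩ := h.lipschitz_deriv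
    ⟨K, fun x y => by rw [neg_sub_neg, abs_sub_comm]; exact hK x y⟩

theorem comp_mul_const (h : IsTestFunction f f') (c : ℝ) :
    IsTestFunction (fun x => f (x * c)) (fun x => f' (x * c) * c) where
  hasDerivAt x := by
    have := (h.hasDerivAt (x * c)).comp x ((hasDerivAt_id x).mul_const c)
    simpa [Function.comp_def] using this
  bounded := let ⟨K, hK⟩ := h.bounded; ⟨K, fun _ => hK _⟩
  bounded_deriv := let ⟨K, hK⟩ := h.bounded_deriv
    ⟨K * |c|, fun x => by rw [abs_mul]; exact mul_le_mul_of_nonneg_right (hK _) (abs_nonneg c)⟩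
  lipschitz_deriv := let ⟨K, hK⟩ := h.lipschitz_deriv
    ⟨K * |c| * |c|, fun x y => by
      rw [← sub_mul, abs_mul]
      have := mul_le_mul_of_nonneg_right (hK (x * c) (y * c)) (abs_nonneg c)
      rw [← sub_mul, abs_mul] at this
      linarith⟩

end IsTestFunction

variable {n : ℕ} {f f' : ℝ → ℝ}

theorem hasDerivAt_linStat_of_isTestFunction (h : IsTestFunction f f') (a : UpperIndex n → ℝ)
    (p : UpperIndex n) (s : ℝ) :
    HasDerivAt (fun t => linStat f (Function.update a p t))
      (linStatGrad f' p (Function.update a p s)) s :=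
  let ⟨_, hL⟩ := h.lipschitz_deriv
  hasDerivAt_linStat_update h.hasDerivAt hL a p s

theorem continuous_update_apply (a : UpperIndex n → ℝ) (p : UpperIndex n) :
    Continuous fun t : ℝ => Function.update a p t :=
  continuous_const.update p continuous_id

/-- Under `PI(c)` for the entries, the variance of a linear spectral statistic is controlled by the
mean of the linear statistic of `f'²`. -/
theorem variance_linStat_le (h : IsTestFunction f f') (μ : UpperIndex n → Measure ℝ)
    [∀ p, IsProbabilityMeasure (μ p)] {c : ℝ} (hc : 0 ≤ c) (hμ : ∀ p, PoincareInequality (μ p) c) :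
    (∫ a, linStat f a ^ 2 ∂Measure.pi μ) - (∫ a, linStat f a ∂Measure.pi μ) ^ 2 ≤
      2 * c / (n : ℝ) ^ 2 * ∫ a, linStat (fun x => f' x ^ 2) a ∂Measure.pi μ := by
  obtain ⟨K, hK⟩ := h.bounded
  obtain ⟨L, hL⟩ := h.exists_linStatGrad_le n
  have hK0 : 0 ≤ K := (abs_nonneg _).trans (hK 0)
  have hsq : ∀ p (a : UpperIndex n → ℝ), |c * linStatGrad f' p a ^ 2| ≤ c * L ^ 2 := fun p a => by
    rw [abs_mul, abs_of_nonneg hc, abs_pow]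
    exact mul_le_mul_of_nonneg_left (pow_le_pow_left₀ (abs_nonneg _) (hL p a) 2) hc
  have hRm : ∀ p : UpperIndex n, Measurable fun a => c * linStatGrad f' p a ^ 2 := fun p =>
    (((h.continuous_linStatGrad p).pow 2).const_mul c).measurable
  have key := phiEntropy_pi_le (φ := fun x => x ^ 2) (φ' := fun x => 2 * x) (α := -K) (β := K)
    (by fun_prop) (by fun_prop) ⟨2 * K, fun x hx => by
      rw [abs_mul, abs_two]; exact mul_le_mul_of_nonneg_left (abs_le.2 hx) zero_le_two⟩
    (phiEntropyConvex_sq _ _) μ h.continuous_linStat.measurable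
    (fun a => abs_le.1 (abs_linStat_le hK0 hK a)) (R := fun p a => c * linStatGrad f' p a ^ 2)
    hRm hsq fun p a => by
      rw [integral_const_mul]
      exact (hμ p).of_hasDerivAt (hasDerivAt_linStat_of_isTestFunction h a p)
        ((h.continuous_linStatGrad p).comp (continuous_update_apply a p))
        (fun t => abs_linStat_le hK0 hK _) (fun t => hL p _)
  refine key.trans ?_
  rw [← integral_finsetSum _ fun p _ => integrable_of_bounded (hRm p) (hsq p), ← integral_const_mul]
  obtain ⟨L', hL'⟩ := h.bounded_deriv
  refine integral_mono (integrable_finsetSum _ fun p _ => integrable_of_bounded (hRm p) (hsq p))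
    (integrable_of_bounded (C := |2 * c / (n : ℝ) ^ 2| * L' ^ 2)
      (h.continuous_linStat_sq.const_mul _).measurable fun a => ?_) fun a => ?_
  · rw [abs_mul]
    refine mul_le_mul_of_nonneg_left (abs_linStat_le (sq_nonneg _) (fun x => ?_) a) (abs_nonneg _)
    rw [abs_pow]
    exact pow_le_pow_left₀ (abs_nonneg _) (hL' x) 2
  · rw [← Finset.mul_sum]
    calc _ ≤ c * (2 / (n : ℝ) ^ 2 * linStat (fun x => f' x ^ 2) a) :=
          mul_le_mul_of_nonneg_left (sum_linStatGrad_sq_le f' a) hc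
      _ = _ := by ring

/-- Under `LSI(c)` for the entries, the entropy of the exponential of a linear spectral statistic
is controlled by the tilted mean of the linear statistic of `f'²`. -/
theorem entropy_exp_linStat_le (h : IsTestFunction f f') (μ : UpperIndex n → Measure ℝ)
    [∀ p, IsProbabilityMeasure (μ p)] {c : ℝ} (hc : 0 ≤ c)
    (hμ : ∀ p, LogSobolevInequality (μ p) c) (t : ℝ) :
    phiEntropy (fun x => x * Real.log x) (Measure.pi μ) (fun a => Real.exp (t * linStat f a)) ≤
      ∫ a, t ^ 2 * (c / (n : ℝ) ^ 2) * linStat (fun x => f' x ^ 2) a * Real.exp (t * linStat f a)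
        ∂Measure.pi μ := by
  obtain ⟨K, hK⟩ := h.bounded
  obtain ⟨L, hL⟩ := h.exists_linStatGrad_le n
  obtain ⟨L', hL'⟩ := h.bounded_deriv
  have hK0 : 0 ≤ K := (abs_nonneg _).trans (hK 0)
  have hS : ∀ (s : ℝ) (a : UpperIndex n → ℝ), |s * linStat f a| ≤ |s| * K := fun s a => by
    rw [abs_mul]; exact mul_le_mul_of_nonneg_left (abs_linStat_le hK0 hK a) (abs_nonneg s)
  have hexp : ∀ (s : ℝ) (a : UpperIndex n → ℝ), |Real.exp (s * linStat f a)| ≤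
      Real.exp (|s| * K) := fun s a => by
    rw [Real.abs_exp]; exact Real.exp_le_exp.2 (abs_le.1 (hS s a)).2
  have hcexp : ∀ s : ℝ, Continuous fun a : UpperIndex n → ℝ => Real.exp (s * linStat f a) :=
    fun s => Real.continuous_exp.comp (h.continuous_linStat.const_mul s)
  set R : UpperIndex n → (UpperIndex n → ℝ) → ℝ := fun p a =>
    2 * c * (t / 2 * linStatGrad f' p a * Real.exp (t / 2 * linStat f a)) ^ 2 with hR
  have hRm : ∀ p, Measurable (R p) := fun p =>
    ((((((h.continuous_linStatGrad p).const_mul (t / 2)).mul (hcexp (t / 2)))).pow 2).const_mul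
      (2 * c)).measurable
  have hGb : ∀ p (a : UpperIndex n → ℝ),
      |t / 2 * linStatGrad f' p a * Real.exp (t / 2 * linStat f a)| ≤
        |t / 2| * L * Real.exp (|t / 2| * K) := fun p a => by
    rw [abs_mul, abs_mul]
    have hL0 : 0 ≤ L := (abs_nonneg _).trans (hL p a)
    exact mul_le_mul (mul_le_mul_of_nonneg_left (hL p a) (abs_nonneg _)) (hexp _ _)
      (abs_nonneg _) (by positivity)
  have hRb : ∀ p a, |R p a| ≤ 2 * c * (|t / 2| * L * Real.exp (|t / 2| * K)) ^ 2 := fun p a => by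
    rw [hR, abs_mul, abs_of_nonneg (by positivity : 0 ≤ 2 * c), abs_pow]
    exact mul_le_mul_of_nonneg_left (pow_le_pow_left₀ (abs_nonneg _) (hGb p a) 2) (by positivity)
  have hee : ∀ a : UpperIndex n → ℝ,
      Real.exp (t / 2 * linStat f a) ^ 2 = Real.exp (t * linStat f a) := fun a => by
    rw [← Real.exp_nat_mul]; congr 1; push_cast; ring
  have key := phiEntropy_pi_le (φ := fun x => x * Real.log x) (φ' := fun x => Real.log x + 1)
    (α := Real.exp (-(|t| * K))) (β := Real.exp (|t| * K))
    Real.continuous_mul_log (Real.measurable_log.add_const 1) ⟨|t| * K + 1, fun x hx => by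
      have hx0 : 0 < x := (Real.exp_pos _).trans_le hx.1
      refine (abs_add_le _ _).trans ?_
      rw [abs_one]
      refine add_le_add_left (abs_le.2 ⟨?_, ?_⟩) 1
      · rw [Real.le_log_iff_exp_le hx0]; exact hx.1
      · rw [Real.log_le_iff_le_exp hx0]; exact hx.2⟩
    (phiEntropyConvex_mul_log (Real.exp_pos _)) μ (hcexp t).measurable
    (fun a => ⟨Real.exp_le_exp.2 (abs_le.1 (hS t a)).1, Real.exp_le_exp.2 (abs_le.1 (hS t a)).2⟩)
    (R := R) hRm hRb fun p a => by
      rw [integral_const_mul]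
      have := (hμ p).of_hasDerivAt
        (g := fun s => Real.exp (t / 2 * linStat f (Function.update a p s)))
        (g' := fun s => t / 2 * linStatGrad f' p (Function.update a p s) *
          Real.exp (t / 2 * linStat f (Function.update a p s)))
        (fun s => by
          have := ((hasDerivAt_linStat_of_isTestFunction h a p s).const_mul (t / 2)).exp
          rwa [mul_comm] at this)
        ((((h.continuous_linStatGrad p).const_mul (t / 2)).mul (hcexp (t / 2))).comp
          (continuous_update_apply a p))
        (fun s => hexp _ _) (fun s => hGb p _)
      simp only [hee] at this
      exact this
  refine key.trans ?_
  rw [← integral_finsetSum _ fun p _ => integrable_of_bounded (hRm p) (hRb p)]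
  refine integral_mono (integrable_finsetSum _ fun p _ => integrable_of_bounded (hRm p) (hRb p))
    (integrable_of_bounded (C := |t ^ 2 * (c / (n : ℝ) ^ 2)| * L' ^ 2 * Real.exp (|t| * K))
      ((h.continuous_linStat_sq.const_mul _).mul (hcexp t)).measurable fun a => ?_) fun a => ?_
  · rw [abs_mul, abs_mul]
    refine mul_le_mul (mul_le_mul_of_nonneg_left (abs_linStat_le (sq_nonneg _) (fun x => ?_) a)
      (abs_nonneg _)) (hexp _ _) (abs_nonneg _) (by positivity)
    rw [abs_pow]
    exact pow_le_pow_left₀ (abs_nonneg _) (hL' x) 2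
  · have e : ∑ p, R p a = c * t ^ 2 / 2 * Real.exp (t * linStat f a) *
        ∑ p, linStatGrad f' p a ^ 2 := by
      rw [Finset.mul_sum]
      refine Finset.sum_congr rfl fun p _ => ?_
      simp only [hR]
      rw [mul_pow, hee]
      ring
    dsimp only
    rw [e]
    calc _ ≤ c * t ^ 2 / 2 * Real.exp (t * linStat f a) *
          (2 / (n : ℝ) ^ 2 * linStat (fun x => f' x ^ 2) a) :=
          mul_le_mul_of_nonneg_left (sum_linStatGrad_sq_le f' a) (by positivity)
      _ = _ := by ring

/-- A Hamilton–Jacobi form of Herbst's argument. The condition `κ m'² + r m' ≤ 0` with `κ = c / n²`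
says that `m(y + r t)` is a subsolution of `∂ₜ m + κ (∂ᵧ m)² = 0`; by the entropy bound
`t⁻¹ log ∫ exp(t S_{m(· + r t)})` is then nonincreasing in `t`, and its limit at `0` is the mean of
the linear statistic of `m`. -/
theorem integral_exp_linStat_le {m m' : ℝ → ℝ} (h : IsTestFunction m m')
    (μ : UpperIndex n → Measure ℝ) [∀ p, IsProbabilityMeasure (μ p)] {c : ℝ} (hc : 0 ≤ c)
    (hμ : ∀ p, LogSobolevInequality (μ p) c) {r : ℝ}
    (hm : ∀ y, c / (n : ℝ) ^ 2 * m' y ^ 2 + r * m' y ≤ 0) {T : ℝ} (hT : 0 < T) :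
    ∫ a, Real.exp (T * linStat (fun y => m (y + r * T)) a) ∂Measure.pi μ ≤
      Real.exp (T * ∫ a, linStat m a ∂Measure.pi μ) := by
  set ν := Measure.pi μ
  obtain ⟨K, hK⟩ := h.bounded
  obtain ⟨L, hL⟩ := h.bounded_deriv
  have hK0 : 0 ≤ K := (abs_nonneg _).trans (hK 0)
  have hL0 : 0 ≤ L := (abs_nonneg _).trans (hL 0)
  set Z : ℝ → (UpperIndex n → ℝ) → ℝ := fun t => linStat fun y => m (y + r * t) with hZ
  set W : ℝ → (UpperIndex n → ℝ) → ℝ := fun t => linStat fun y => m' (y + r * t) with hW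
  have hZb : ∀ t a, |Z t a| ≤ K := fun t a => abs_linStat_le hK0 (fun _ => hK _) a
  have hWb : ∀ t a, |W t a| ≤ L := fun t a => abs_linStat_le hL0 (fun _ => hL _) a
  have hZc : ∀ t, Continuous (Z t) := fun t => (h.comp_add_const (r * t)).continuous_linStat
  have hWc : ∀ t, Continuous (W t) := fun t => (h.comp_add_const (r * t)).continuous_linStat_deriv
  have hZd : ∀ t a, HasDerivAt (fun t => Z t a) (r * W t a) t := by
    intro t a
    have : ∀ i : Fin n, HasDerivAt
        (fun t => m ((wignerMatrix_isHermitian a).eigenvalues i + r * t))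
        (r * m' ((wignerMatrix_isHermitian a).eigenvalues i + r * t)) t := fun i => by
      have h1 : HasDerivAt (fun t => (wignerMatrix_isHermitian a).eigenvalues i + r * t) r t := by
        simpa using ((hasDerivAt_id t).const_mul r).const_add
              ((wignerMatrix_isHermitian a).eigenvalues i)
      rw [mul_comm]
      exact (h.hasDerivAt _).comp t h1
    have h2 := (HasDerivAt.fun_sum fun i (_ : i ∈ Finset.univ) => this i).div_const (n : ℝ)
    rw [← Finset.mul_sum, mul_div_assoc] at h2
    exact h2
  set M : ℝ → ℝ := fun t => ∫ a, Real.exp (t * Z t a) ∂ν with hM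
  have hEc : ∀ t, Continuous fun a => Real.exp (t * Z t a) := fun t =>
    Real.continuous_exp.comp ((hZc t).const_mul t)
  have hEb : ∀ t a, Real.exp (t * Z t a) ≤ Real.exp (|t| * K) := fun t a =>
    Real.exp_le_exp.2 ((le_abs_self _).trans (by
      rw [abs_mul]; exact mul_le_mul_of_nonneg_left (hZb t a) (abs_nonneg t)))
  have hEi : ∀ t, Integrable (fun a => Real.exp (t * Z t a)) ν := fun t =>
    integrable_of_bounded (hEc t).measurable fun a => by rw [Real.abs_exp]; exact hEb t a
  have hZEi : ∀ t, Integrable (fun a => Z t a * Real.exp (t * Z t a)) ν := fun t =>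
    integrable_of_bounded (C := K * Real.exp (|t| * K)) ((hZc t).mul (hEc t)).measurable fun a => by
      rw [abs_mul, Real.abs_exp]
      exact mul_le_mul (hZb t a) (hEb t a) (Real.exp_pos _).le hK0
  have hWEi : ∀ t, Integrable (fun a => W t a * Real.exp (t * Z t a)) ν := fun t =>
    integrable_of_bounded (C := L * Real.exp (|t| * K)) ((hWc t).mul (hEc t)).measurable fun a => by
      rw [abs_mul, Real.abs_exp]
      exact mul_le_mul (hWb t a) (hEb t a) (Real.exp_pos _).le hL0
  have hMpos : ∀ t, 0 < M t := fun t => integral_exp_pos (hEi t)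
  set M' : ℝ → ℝ := fun t => ∫ a, (Z t a + t * (r * W t a)) * Real.exp (t * Z t a) ∂ν with hM'
  have hMd : ∀ t, HasDerivAt M (M' t) t := by
    intro t
    refine (hasDerivAt_integral_of_dominated_loc_of_deriv_le
      (F := fun t a => Real.exp (t * Z t a))
      (F' := fun t a => (Z t a + t * (r * W t a)) * Real.exp (t * Z t a))
      (bound := fun _ => (K + (|t| + 1) * (|r| * L)) * Real.exp ((|t| + 1) * K))
      (s := Metric.ball t 1) (Metric.ball_mem_nhds t one_pos)
      (Eventually.of_forall fun s => (hEc s).aestronglyMeasurable) (hEi t)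
      (((hZc t).add (((hWc t).const_mul r).const_mul t)).mul (hEc t)).aestronglyMeasurable
      (Eventually.of_forall fun a s hs => ?_) (integrable_const _)
      (Eventually.of_forall fun a s _ => ?_)).2
    · have hs' : |s| ≤ |t| + 1 := by
        rw [Metric.mem_ball, Real.dist_eq] at hs
        have := abs_sub_abs_le_abs_sub s t
        linarith
      rw [Real.norm_eq_abs, abs_mul, Real.abs_exp]
      refine mul_le_mul ((abs_add_le _ _).trans (add_le_add (hZb s a) ?_))
        ((hEb s a).trans (Real.exp_le_exp.2 (mul_le_mul_of_nonneg_right hs' hK0)))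
        (Real.exp_pos _).le (by positivity)
      rw [abs_mul, abs_mul]
      exact mul_le_mul hs' (mul_le_mul_of_nonneg_left (hWb s a) (abs_nonneg r))
        (by positivity) (by positivity)
    · have h1 := ((hasDerivAt_id s).mul (hZd s a)).exp
      simp only [id, one_mul] at h1
      rw [mul_comm]
      exact h1
  have hode : ∀ t, t * M' t - M t * Real.log (M t) ≤ 0 := by
    intro t
    have h1 := entropy_exp_linStat_le (h.comp_add_const (r * t)) μ hc hμ t
    have h2 : t * M' t = ∫ a, Real.exp (t * Z t a) * Real.log (Real.exp (t * Z t a)) ∂ν +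
        ∫ a, t ^ 2 * r * (W t a * Real.exp (t * Z t a)) ∂ν := by
      rw [hM', ← integral_const_mul, ← integral_add]
      · refine integral_congr_ae (Eventually.of_forall fun a => ?_)
        simp only [Real.log_exp]
        ring
      · simp only [Real.log_exp]
        refine ((hZEi t).const_mul t).congr (Eventually.of_forall fun a => ?_)
        simp only
        ring
      · exact (hWEi t).const_mul _
    have h3 : ∫ a, t ^ 2 * (c / (n : ℝ) ^ 2) * linStat (fun x => m' (x + r * t) ^ 2) a *
        Real.exp (t * linStat (fun x => m (x + r * t)) a) ∂ν ≤
        - ∫ a, t ^ 2 * r * (W t a * Real.exp (t * Z t a)) ∂ν := by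
      rw [← integral_neg]
      refine integral_mono_of_nonneg (Eventually.of_forall fun a => ?_)
        ((hWEi t).const_mul _).neg (Eventually.of_forall fun a => ?_)
      · have : 0 ≤ linStat (fun x => m' (x + r * t) ^ 2) a :=
          div_nonneg (Finset.sum_nonneg fun _ _ => sq_nonneg _) (Nat.cast_nonneg n)
        exact mul_nonneg (mul_nonneg (by positivity) this) (Real.exp_pos _).le
      · have h4 : c / (n : ℝ) ^ 2 * linStat (fun x => m' (x + r * t) ^ 2) a + r * W t a ≤ 0 := by
          rw [hW, ← linStat_const_mul, ← linStat_const_mul, ← linStat_add]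
          exact div_nonpos_of_nonpos_of_nonneg (Finset.sum_nonpos fun _ _ => hm _)
            (Nat.cast_nonneg n)
        have h5 := mul_nonneg_of_nonpos_of_nonpos h4
          (neg_nonpos.2 (mul_nonneg (sq_nonneg t) (Real.exp_pos (t * Z t a)).le))
        dsimp only
        linarith
    rw [phiEntropy] at h1
    linarith
  have hlogd : ∀ t, HasDerivAt (fun t => Real.log (M t)) (M' t / M t) t := fun t =>
    (hMd t).log (hMpos t).ne'
  have hanti : AntitoneOn (fun t => Real.log (M t) / t) (Set.Ioi 0) := by
    have hd : ∀ t ∈ Set.Ioi (0 : ℝ), HasDerivAt (fun t => Real.log (M t) / t)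
        ((M' t / M t * t - Real.log (M t) * 1) / t ^ 2) t := fun t ht =>
      (hlogd t).div (hasDerivAt_id t) (ne_of_gt ht)
    refine antitoneOn_of_deriv_nonpos (convex_Ioi 0)
      (fun t ht => (hd t ht).continuousAt.continuousWithinAt)
      (fun t ht => (hd t (interior_subset ht)).differentiableAt.differentiableWithinAt)
      fun t ht => ?_
    rw [(hd t (interior_subset ht)).deriv]
    refine div_nonpos_of_nonpos_of_nonneg ?_ (sq_nonneg t)
    have h1 := hode t
    have h2 : M' t / M t * t - Real.log (M t) * 1 = (t * M' t - M t * Real.log (M t)) / M t := by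
      have := (hMpos t).ne'
      field_simp
    rw [h2]
    exact div_nonpos_of_nonpos_of_nonneg h1 (hMpos t).le
  have hM0 : M 0 = 1 := by simp [hM]
  have hM'0 : M' 0 = ∫ a, linStat m a ∂ν := by simp [hM', hZ]
  have hlim : Tendsto (fun t => Real.log (M t) / t) (𝓝[>] 0) (𝓝 (∫ a, linStat m a ∂ν)) := by
    have h1 := (hlogd 0).tendsto_slope_zero_right
    rw [hM0, hM'0, div_one, Real.log_one] at h1
    refine h1.congr fun t => ?_
    rw [zero_add, sub_zero, smul_eq_mul, div_eq_inv_mul]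
  have hfin : Real.log (M T) / T ≤ ∫ a, linStat m a ∂ν := by
    refine ge_of_tendsto hlim ?_
    filter_upwards [Ioo_mem_nhdsGT hT] with s hs
    exact hanti hs.1 hT hs.2.le
  rw [div_le_iff₀ hT, Real.log_le_iff_le_exp (hMpos T), mul_comm] at hfin
  exact hfin

end Concentration

/-! ### Lower bounds for the constants, ramps and measurability -/

section ScaleBounds

open Filter Topology

/-- A measure with variance one satisfies `PI(c)` only for `c ≥ 1`: test with `k sin(x/k)`. -/
theorem PoincareInequality.one_le {μ : Measure ℝ} [IsProbabilityMeasure μ] {c : ℝ} (hc : 0 ≤ c)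
    (h : PoincareInequality μ c) (h0 : ∫ x, x ∂μ = 0) (h1 : ∫ x, x ^ 2 ∂μ = 1) : 1 ≤ c := by
  have hi2 : Integrable (fun x : ℝ => x ^ 2) μ := by
    by_contra hcon
    rw [integral_undef hcon] at h1
    exact zero_ne_one h1
  have hi1 : Integrable (fun x : ℝ => x) μ := by
    refine (hi2.add (integrable_const (1 : ℝ))).mono' (by fun_prop) (Eventually.of_forall fun x => ?_)
    rw [Real.norm_eq_abs, Pi.add_apply]
    nlinarith [sq_abs x, sq_nonneg (|x| - 1), abs_nonneg x]
  let k : ℕ → ℝ := fun j => (j : ℝ) + 1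
  have hk : ∀ j, 0 < k j := fun j => by positivity
  let g : ℕ → ℝ → ℝ := fun j x => k j * Real.sin (x / k j)
  have hgd : ∀ j x, HasDerivAt (g j) (Real.cos (x / k j)) x := fun j x => by
    have h2 := (((hasDerivAt_id x).div_const (k j)).sin).const_mul (k j)
    have h3 : k j * (Real.cos (id x / k j) * (1 / k j)) = Real.cos (x / k j) := by
      have := (hk j).ne'
      simp only [id]
      field_simp
    rw [h3] at h2
    exact h2
  have hgle : ∀ j x, |g j x| ≤ |x| := fun j x => by
    rw [abs_mul, abs_of_pos (hk j)]
    have := mul_le_mul_of_nonneg_left (Real.abs_sin_le_abs (x := x / k j)) (hk j).le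
    rwa [abs_div, abs_of_pos (hk j), mul_div_cancel₀ _ (hk j).ne'] at this
  have hglim : ∀ x, Tendsto (fun j => g j x) atTop (𝓝 x) := fun x => by
    have h2 : HasDerivAt (fun t : ℝ => Real.sin (x * t)) x 0 := by
      have := ((hasDerivAt_id (0 : ℝ)).const_mul x).sin
      simpa using this
    have h3 := h2.tendsto_slope_zero_right.comp (show Tendsto (fun j => (k j)⁻¹) atTop (𝓝[>] 0) by
      refine tendsto_nhdsWithin_iff.2 ⟨?_, Eventually.of_forall fun j => inv_pos.2 (hk j)⟩
      have := tendsto_one_div_add_atTop_nhds_zero_nat (𝕜 := ℝ)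
      simpa [k] using this)
    refine h3.congr fun j => ?_
    simp [g, div_eq_mul_inv]
  have hgc : ∀ j, Continuous (g j) := fun j => by fun_prop
  have hl1 : Tendsto (fun j => ∫ x, g j x ∂μ) atTop (𝓝 (∫ x, x ∂μ)) :=
    tendsto_integral_of_dominated_convergence (fun x => |x|)
      (fun j => (hgc j).aestronglyMeasurable) hi1.abs
      (fun j => Eventually.of_forall (hgle j)) (Eventually.of_forall hglim)
  have hl2 : Tendsto (fun j => ∫ x, g j x ^ 2 ∂μ) atTop (𝓝 (∫ x, x ^ 2 ∂μ)) :=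
    tendsto_integral_of_dominated_convergence (fun x => x ^ 2)
      (fun j => ((hgc j).pow 2).aestronglyMeasurable) hi2
      (fun j => Eventually.of_forall fun x => by
        rw [Real.norm_eq_abs, abs_of_nonneg (sq_nonneg _)]; exact sq_le_sq.2 (hgle j x))
      (Eventually.of_forall fun x => (hglim x).pow 2)
  have hl := hl2.sub (hl1.pow 2)
  rw [h0, h1] at hl
  have hle : ∀ j, ∫ x, g j x ^ 2 ∂μ - (∫ x, g j x ∂μ) ^ 2 ≤ c := fun j => by
    have hcos : ∀ x, |Real.cos (x / k j) ^ 2| ≤ 1 := fun x => by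
      rw [abs_of_nonneg (sq_nonneg _)]; exact Real.cos_sq_le_one _
    refine (h.of_hasDerivAt (hgd j) (by fun_prop) (K := k j) (L := 1) (fun x => ?_)
      fun x => Real.abs_cos_le_one _).trans ?_
    · rw [abs_mul, abs_of_pos (hk j)]
      exact mul_le_of_le_one_right (hk j).le (Real.abs_sin_le_one _)
    · refine mul_le_of_le_one_right hc ?_
      have := integral_mono (μ := μ) (integrable_of_bounded (C := 1) (by fun_prop) hcos)
        (integrable_const (1 : ℝ)) fun x => (abs_le.1 (hcos x)).2
      simpa using this
  have := le_of_tendsto' hl hle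
  simpa using this

/-- `LSI(c)` implies `PI(2c)`, because `Var(f) ≤ Ent(f²)` for `f > 0`. -/
theorem LogSobolevInequality.poincareInequality {μ : Measure ℝ} [IsProbabilityMeasure μ] {c : ℝ}
    (h : LogSobolevInequality μ c) : PoincareInequality μ (2 * c) := by
  intro g hg ⟨K, hK⟩ hg'
  let f : ℝ → ℝ := fun x => g x + (K + 1)
  have hfc : Continuous f := hg.continuous.add continuous_const
  have hf1 : ∀ x, 1 ≤ f x := fun x => by linarith [(abs_le.1 (hK x)).1]
  have hf2 : ∀ x, f x ≤ 2 * K + 1 := fun x => by linarith [(abs_le.1 (hK x)).2]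
  have hfa : ∀ x, |f x| ≤ 2 * K + 1 := fun x => by
    rw [abs_of_nonneg (zero_le_one.trans (hf1 x))]; exact hf2 x
  have hder : deriv f = deriv g := by ext x; simp [f]
  have hlsi := h f (hg.add contDiff_const) ⟨2 * K + 1, hfa⟩ (by rw [hder]; exact hg')
  rw [hder] at hlsi
  refine le_trans ?_ hlsi
  have hpow : ∀ x, |f x ^ 2| ≤ (2 * K + 1) ^ 2 := fun x => by
    rw [abs_pow]; exact pow_le_pow_left₀ (abs_nonneg _) (hfa x) 2
  have if1 : Integrable f μ := integrable_of_bounded hfc.measurable hfa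
  have if2 : Integrable (fun x => f x ^ 2) μ := integrable_of_bounded (hfc.pow 2).measurable hpow
  have ig1 : Integrable g μ := integrable_of_bounded hg.continuous.measurable hK
  have ig2 : Integrable (fun x => g x ^ 2) μ :=
    integrable_of_bounded (C := K ^ 2) (hg.continuous.pow 2).measurable fun x => by
      rw [abs_pow]; exact pow_le_pow_left₀ (abs_nonneg _) (hK x) 2
  obtain ⟨M, hM⟩ := (isCompact_Icc (a := 0) (b := (2 * K + 1) ^ 2)).exists_bound_of_continuousOn
    (f := fun y : ℝ => y * Real.log y) Real.continuous_mul_log.continuousOn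
  have ifl : Integrable (fun x => f x ^ 2 * Real.log (f x ^ 2)) μ :=
    integrable_of_bounded (C := M)
      (Real.continuous_mul_log.comp (hfc.pow 2)).measurable
      fun x => hM _ ⟨sq_nonneg _, (abs_le.1 (hpow x)).2⟩
  set b := ∫ x, f x ∂μ with hb
  set A := ∫ x, f x ^ 2 ∂μ with hA
  have hb1 : 1 ≤ b := by
    simpa using integral_mono (μ := μ) (integrable_const (1 : ℝ)) if1 hf1
  have hA1 : 1 ≤ A := by
    simpa using integral_mono (μ := μ) (integrable_const (1 : ℝ)) if2 fun x => one_le_pow₀ (hf1 x)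
  have hb0 : 0 < b := by linarith
  have hA0 : 0 < A := by linarith
  -- The variance does not see the added constant.
  have hvar : ∫ x, g x ^ 2 ∂μ - (∫ x, g x ∂μ) ^ 2 = A - b ^ 2 := by
    have e1 : b = ∫ x, g x ∂μ + (K + 1) := by
      rw [hb, integral_add ig1 (integrable_const _)]; simp
    have e2 : A = ∫ x, g x ^ 2 ∂μ + 2 * (K + 1) * ∫ x, g x ∂μ + (K + 1) ^ 2 := by
      have : ∀ x, f x ^ 2 = g x ^ 2 + 2 * (K + 1) * g x + (K + 1) ^ 2 := fun x => by
        simp only [f]; ring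
      rw [hA]
      simp_rw [this]
      rw [integral_add (by fun_prop) (by fun_prop), integral_add (by fun_prop) (by fun_prop),
        integral_const_mul]
      simp
    rw [e1, e2]; ring
  -- Write `f² / A` as `(f b / A) * (f / b)` and use `log z ≥ 1 - 1/z` for both factors.
  have key : ∀ x, (f x ^ 2 - A / b * f x) + (f x ^ 2 - b * f x) ≤
      f x ^ 2 * Real.log (f x ^ 2) - Real.log A * f x ^ 2 := fun x => by
    have hx : 0 < f x := zero_lt_one.trans_le (hf1 x)
    have l1 := Real.one_sub_inv_le_log_of_pos (show 0 < f x * b / A by positivity)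
    have l2 := Real.one_sub_inv_le_log_of_pos (show 0 < f x / b by positivity)
    rw [Real.log_div (by positivity) hA0.ne', Real.log_mul hx.ne' hb0.ne'] at l1
    rw [Real.log_div hx.ne' hb0.ne'] at l2
    have l3 := mul_le_mul_of_nonneg_left (add_le_add l1 l2) (sq_nonneg (f x))
    have e1 : f x ^ 2 * (1 - (f x * b / A)⁻¹ + (1 - (f x / b)⁻¹)) =
        (f x ^ 2 - A / b * f x) + (f x ^ 2 - b * f x) := by
      field_simp
    have e2 : Real.log (f x ^ 2) = 2 * Real.log (f x) := by
      rw [Real.log_pow]; norm_num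
    rw [e1] at l3
    rw [e2]
    linarith
  have hint := integral_mono (μ := μ) (by fun_prop) (by fun_prop) key
  rw [integral_add (by fun_prop) (by fun_prop), integral_sub (by fun_prop) (by fun_prop),
    integral_sub (by fun_prop) (by fun_prop), integral_sub (by fun_prop) (by fun_prop),
    integral_const_mul, integral_const_mul, integral_const_mul,
    ← hb, ← hA, div_mul_cancel₀ _ hb0.ne'] at hint
  rw [hvar]
  unfold entropyFunctional
  rw [← hA]
  linarith

end ScaleBounds

section Ramp

open Filter Topology

/-- A smooth nonincreasing cutoff `q`, equal to `1` on `(-∞, 0]` and to `0` on `[1, ∞)`, with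
derivative `q'` and `|q'| ≤ B`. -/
structure IsRamp (q q' : ℝ → ℝ) (B : ℝ) : Prop where
  isTestFunction : IsTestFunction q q'
  antitone : Antitone q
  eq_one : ∀ v ≤ 0, q v = 1
  eq_zero : ∀ v, 1 ≤ v → q v = 0
  deriv_nonpos : ∀ v, q' v ≤ 0
  neg_le_deriv : ∀ v, -B ≤ q' v
  deriv_eq_zero : ∀ v, v ∉ Set.Ioc 0 1 → q' v = 0
  pos : 0 < B

theorem exists_isRamp : ∃ q q' B, IsRamp q q' B := by
  let q : ℝ → ℝ := fun v => Real.smoothTransition (1 - v)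
  have hq : ContDiff ℝ 2 q := Real.smoothTransition.contDiff.comp (contDiff_const.sub contDiff_id)
  have hq1 : ContDiff ℝ 1 (deriv q) := by
    rw [show (2 : WithTop ℕ∞) = 1 + 1 by norm_num, contDiff_succ_iff_deriv] at hq
    exact hq.2.2
  have hq2 : Continuous (deriv (deriv q)) := hq1.continuous_deriv le_rfl
  have hanti : Antitone q := fun x y h => Real.smoothTransition.monotone (by linarith)
  have hone : ∀ v ≤ 0, q v = 1 := fun v hv => Real.smoothTransition.one_of_one_le (by linarith)
  have hzero : ∀ v, 1 ≤ v → q v = 0 := fun v hv =>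
    Real.smoothTransition.zero_of_nonpos (by linarith)
  have hd0 : ∀ v < 0, deriv q v = 0 := fun v hv => by
    have : q =ᶠ[𝓝 v] fun _ => 1 := by
      filter_upwards [Iio_mem_nhds hv] with w hw using hone w (le_of_lt hw)
    rw [this.deriv_eq]; simp
  have hd1 : ∀ v, 1 < v → deriv q v = 0 := fun v hv => by
    have : q =ᶠ[𝓝 v] fun _ => 0 := by
      filter_upwards [Ioi_mem_nhds hv] with w hw using hzero w (le_of_lt hw)
    rw [this.deriv_eq]; simp
  have hd00 : deriv q 0 = 0 := by
    have h1 : Tendsto (deriv q) (𝓝[<] 0) (𝓝 (deriv q 0)) :=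
      (hq1.continuous.tendsto 0).mono_left nhdsWithin_le_nhds
    refine tendsto_nhds_unique h1 (tendsto_const_nhds.congr' ?_)
    filter_upwards [self_mem_nhdsWithin] with w hw using (hd0 w hw).symm
  have hdd0 : ∀ v < 0, deriv (deriv q) v = 0 := fun v hv => by
    have : deriv q =ᶠ[𝓝 v] fun _ => 0 := by
      filter_upwards [Iio_mem_nhds hv] with w hw using hd0 w hw
    rw [this.deriv_eq]; simp
  have hdd1 : ∀ v, 1 < v → deriv (deriv q) v = 0 := fun v hv => by
    have : deriv q =ᶠ[𝓝 v] fun _ => 0 := by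
      filter_upwards [Ioi_mem_nhds hv] with w hw using hd1 w hw
    rw [this.deriv_eq]; simp
  have hbd : ∀ u : ℝ → ℝ, Continuous u → (∀ v < 0, u v = 0) → (∀ v, 1 < v → u v = 0) →
      ∃ M, 0 < M ∧ ∀ v, |u v| ≤ M := by
    intro u hu h0 h1
    obtain ⟨M, hM⟩ := (isCompact_Icc (a := (0 : ℝ)) (b := 1)).exists_bound_of_continuousOn
      hu.continuousOn
    refine ⟨max M 1, by positivity, fun v => ?_⟩
    rcases lt_or_ge v 0 with hv | hv
    · rw [h0 v hv, abs_zero]; positivity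
    rcases lt_or_ge 1 v with hv' | hv'
    · rw [h1 v hv', abs_zero]; positivity
    · exact (hM v ⟨hv, hv'⟩).trans (le_max_left _ _)
  obtain ⟨B, hB0, hB⟩ := hbd _ hq1.continuous hd0 hd1
  obtain ⟨M, hM0, hM⟩ := hbd _ hq2 hdd0 hdd1
  refine ⟨q, deriv q, B, ⟨fun x => (hq.differentiable (by norm_num) x).hasDerivAt, ⟨1, fun x => ?_⟩,
    ⟨B, hB⟩, ⟨M, fun x y => ?_⟩⟩, hanti, hone, hzero, fun v => hanti.deriv_nonpos,
    fun v => (abs_le.1 (hB v)).1, fun v hv => ?_, hB0⟩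
  · rw [abs_of_nonneg (Real.smoothTransition.nonneg _)]
    exact Real.smoothTransition.le_one _
  · exact convex_univ.norm_image_sub_le_of_norm_hasDerivWithin_le (f := deriv q)
      (fun z _ => ((hq1.differentiable (by norm_num) z).hasDerivAt).hasDerivWithinAt)
      (fun z _ => hM z) (Set.mem_univ y) (Set.mem_univ x)
  · rcases lt_trichotomy v 0 with h | h | h
    · exact hd0 v h
    · rw [h, hd00]
    · exact hd1 v (by by_contra hcon; exact hv ⟨h, not_lt.1 hcon⟩)

namespace IsRamp

variable {q q' : ℝ → ℝ} {B : ℝ}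

theorem nonneg (h : IsRamp q q' B) (v : ℝ) : 0 ≤ q v := by
  rw [← h.eq_zero (max v 1) (le_max_right _ _)]; exact h.antitone (le_max_left _ _)

theorem le_one (h : IsRamp q q' B) (v : ℝ) : q v ≤ 1 := by
  rw [← h.eq_one (min v 0) (min_le_right _ _)]; exact h.antitone (min_le_left _ _)

theorem continuous (h : IsRamp q q' B) : Continuous q :=
  continuous_iff_continuousAt.2 fun x => (h.isTestFunction.hasDerivAt x).continuousAt

theorem isTestFunction_comp (h : IsRamp q q' B) (x k : ℝ) :
    IsTestFunction (fun y => q ((y - x) * k)) (fun y => q' ((y - x) * k) * k) := by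
  simpa only [sub_eq_add_neg] using (h.isTestFunction.comp_mul_const k).comp_add_const (-x)

variable {n : ℕ}

theorem measurable_linStat (h : IsRamp q q' B) (k : ℝ) :
    Measurable fun z : (UpperIndex n → ℝ) × ℝ => linStat (fun y => q ((y - z.2) * k)) z.1 := by
  have := measurable_uncurry_of_continuous_of_measurable
    (u := fun (x : ℝ) (a : UpperIndex n → ℝ) => linStat (fun y => q ((y - x) * k)) a)
    (fun a => by
      have := h.continuous
      unfold linStat
      fun_prop)
    (fun x => (h.isTestFunction_comp x k).continuous_linStat.measurable)
  have hs : Measurable (Prod.swap : (UpperIndex n → ℝ) × ℝ → ℝ × (UpperIndex n → ℝ)) :=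
    measurable_swap
  have h2 := this.comp hs
  exact h2

end IsRamp

/-- The spectral distribution function is a pointwise limit of linear statistics of ramps, hence
jointly measurable. -/
theorem measurable_spectralCDF {n : ℕ} :
    Measurable fun z : (UpperIndex n → ℝ) × ℝ => spectralCDF z.1 z.2 := by
  obtain ⟨q, q', B, hq⟩ := exists_isRamp
  refine measurable_of_tendsto_metrizable (fun k : ℕ => hq.measurable_linStat (n := n) (k : ℝ)) ?_
  rw [tendsto_pi_nhds]
  rintro ⟨a, x⟩
  simp only [spectralCDF_eq_linStat, linStat]
  refine Tendsto.div_const (tendsto_finsetSum _ fun i _ => ?_) _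
  set l := (wignerMatrix_isHermitian a).eigenvalues i
  split_ifs with hl
  · refine tendsto_const_nhds.congr fun k => (hq.eq_one _ ?_).symm
    exact mul_nonpos_of_nonpos_of_nonneg (by linarith) (Nat.cast_nonneg k)
  · have hl' : 0 < l - x := by linarith [not_le.1 hl]
    obtain ⟨N, hN⟩ := exists_nat_ge (1 / (l - x))
    refine tendsto_const_nhds.congr' ?_
    filter_upwards [eventually_ge_atTop N] with k hk
    refine (hq.eq_zero _ ?_).symm
    have h1 : 1 / (l - x) ≤ k := hN.trans (by exact_mod_cast hk)
    rw [div_le_iff₀ hl'] at h1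
    linarith

theorem measurable_spectralCDF_left {n : ℕ} (x : ℝ) :
    Measurable fun a : UpperIndex n → ℝ => spectralCDF a x := by
  have hp : Measurable fun a : UpperIndex n → ℝ => (a, x) := measurable_prodMk_right
  have h := (measurable_spectralCDF (n := n)).comp hp
  simp only [Function.comp_def] at h
  exact h

theorem spectralCDF_nonneg {n : ℕ} (a : UpperIndex n → ℝ) (x : ℝ) : 0 ≤ spectralCDF a x := by
  unfold spectralCDF empiricalCDF; positivity

theorem spectralCDF_le_one {n : ℕ} (a : UpperIndex n → ℝ) (x : ℝ) : spectralCDF a x ≤ 1 := by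
  unfold spectralCDF empiricalCDF
  refine div_le_one_of_le₀ ?_ (Nat.cast_nonneg n)
  exact_mod_cast (Finset.card_filter_le _ _).trans (by simp)

theorem spectralCDF_mono {n : ℕ} (a : UpperIndex n → ℝ) : Monotone (spectralCDF a) := by
  intro x y hxy
  rw [spectralCDF_eq_linStat, spectralCDF_eq_linStat]
  refine linStat_mono (fun z => ?_) a
  split_ifs with h1 h2
  all_goals first | exact absurd (h1.trans hxy) h2 | norm_num

theorem abs_spectralCDF_le_one {n : ℕ} (a : UpperIndex n → ℝ) (x : ℝ) : |spectralCDF a x| ≤ 1 :=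
  abs_le.2 ⟨by linarith [spectralCDF_nonneg a x], spectralCDF_le_one a x⟩

theorem integrable_spectralCDF {n : ℕ} (ν : Measure (UpperIndex n → ℝ)) [IsProbabilityMeasure ν]
    (x : ℝ) : Integrable (fun a => spectralCDF a x) ν :=
  integrable_of_bounded (measurable_spectralCDF_left x) fun a => abs_spectralCDF_le_one a x

end Ramp

/-! ### The mean Kantorovich distance -/

section Kantorovich

open Filter Topology

variable {n : ℕ}

/-- Weighted integral over `x` of the mass that the spectral measure puts on `(x, x + h]`. -/
theorem lintegral_weight_mul_window_le {w M : ℝ → ℝ} {h : ℝ} (hh : 0 ≤ h)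
    (hwM : ∀ x y, y ∈ Set.Ioc x (x + h) → w x ≤ M y) (hM : ∀ y, 0 ≤ M y) (a : UpperIndex n → ℝ) :
    ∫⁻ x, ENNReal.ofReal (w x * (spectralCDF a (x + h) - spectralCDF a x)) ≤
      ENNReal.ofReal (h * linStat M a) := by
  set l := (wignerMatrix_isHermitian a).eigenvalues
  have hpt : ∀ x, ENNReal.ofReal (w x * (spectralCDF a (x + h) - spectralCDF a x)) ≤
      ∑ i, (Set.Ico (l i - h) (l i)).indicator (fun _ => ENNReal.ofReal (M (l i) / n)) x := by
    intro x
    have e : ∀ i, (Set.Ico (l i - h) (l i)).indicator (fun _ => ENNReal.ofReal (M (l i) / n)) x =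
        ENNReal.ofReal ((Set.Ico (l i - h) (l i)).indicator (fun _ => M (l i) / n) x) := fun i => by
      by_cases hx : x ∈ Set.Ico (l i - h) (l i) <;> simp [hx]
    simp_rw [e]
    rw [← ENNReal.ofReal_sum_of_nonneg fun i _ => Set.indicator_nonneg
      (fun _ _ => div_nonneg (hM _) (Nat.cast_nonneg n)) _]
    refine ENNReal.ofReal_le_ofReal ?_
    rw [spectralCDF_eq_linStat, spectralCDF_eq_linStat, linStat, linStat, ← sub_div,
      ← Finset.sum_sub_distrib, Finset.sum_div, Finset.mul_sum]
    refine Finset.sum_le_sum fun i _ => ?_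
    change w x * (((if l i ≤ x + h then (1 : ℝ) else 0) - if l i ≤ x then 1 else 0) / n) ≤ _
    by_cases h1 : l i ≤ x
    · have h2 : l i ≤ x + h := by linarith
      have h3 : x ∉ Set.Ico (l i - h) (l i) := fun hx => by linarith [hx.2]
      simp [h1, h2, h3]
    · by_cases h2 : l i ≤ x + h
      · have h3 : x ∈ Set.Ico (l i - h) (l i) := ⟨by linarith, not_le.1 h1⟩
        simp only [h1, h2, h3, if_true, if_false, Set.indicator_of_mem, sub_zero]
        rw [mul_one_div]
        exact div_le_div_of_nonneg_right (hwM x _ ⟨not_le.1 h1, h2⟩) (Nat.cast_nonneg n)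
      · have h3 : x ∉ Set.Ico (l i - h) (l i) := fun hx => h2 (by linarith [hx.1])
        simp [h1, h2, h3]
  refine (lintegral_mono hpt).trans ?_
  rw [lintegral_finsetSum _ fun i _ => measurable_const.indicator measurableSet_Ico]
  simp_rw [lintegral_indicator measurableSet_Ico, lintegral_const, Measure.restrict_apply_univ,
    Real.volume_Ico, sub_sub_cancel, ← ENNReal.ofReal_mul' hh]
  rw [← ENNReal.ofReal_sum_of_nonneg fun i _ =>
    mul_nonneg (div_nonneg (hM _) (Nat.cast_nonneg n)) hh]
  refine ENNReal.ofReal_le_ofReal (le_of_eq ?_)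
  rw [linStat, mul_comm, Finset.sum_div, Finset.sum_mul]

/-- A linearized Cauchy–Schwarz inequality for the mean absolute deviation; the free parameter `s`
will be taken to depend on the position of a ramp. -/
theorem integral_abs_sub_integral_le {α : Type*} [MeasurableSpace α] {ν : Measure α}
    [IsProbabilityMeasure ν] {X : α → ℝ} {K s : ℝ} (hX : Measurable X) (hK : ∀ a, |X a| ≤ K)
    (hs : 0 < s) :
    ∫ a, |X a - ∫ b, X b ∂ν| ∂ν ≤ s + (∫ a, X a ^ 2 ∂ν - (∫ a, X a ∂ν) ^ 2) / s := by
  have i1 : Integrable X ν := integrable_of_bounded hX hK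
  have i2 : Integrable (fun a => X a ^ 2) ν :=
    integrable_of_bounded (C := K ^ 2) (hX.pow_const 2) fun a => by
      rw [abs_pow]; exact pow_le_pow_left₀ (abs_nonneg _) (hK a) 2
  set b := ∫ b, X b ∂ν with hb
  have hpt : ∀ a, |X a - b| ≤ s + (X a ^ 2 - 2 * b * X a + b ^ 2) / s := fun a => by
    have h1 : X a ^ 2 - 2 * b * X a + b ^ 2 = |X a - b| ^ 2 := by rw [sq_abs]; ring
    rw [h1, ← sub_le_iff_le_add', le_div_iff₀ hs]
    nlinarith [sq_nonneg (|X a - b| - s), abs_nonneg (X a - b)]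
  have hint := integral_mono (μ := ν) (by fun_prop) (by fun_prop) hpt
  refine hint.trans (le_of_eq ?_)
  rw [integral_add (by fun_prop) (by fun_prop), integral_div, integral_add (by fun_prop) (by fun_prop),
    integral_sub (by fun_prop) (by fun_prop), integral_const_mul, ← hb]
  simp only [integral_const, probReal_univ, one_smul]
  congr 2
  ring

theorem integrable_linStat_sq (hn : n ≠ 0) (μ : UpperIndex n → Measure ℝ)
    [∀ p, IsProbabilityMeasure (μ p)] (h1 : ∀ p, ∫ x, x ^ 2 ∂μ p = 1) :
    Integrable (fun a : UpperIndex n → ℝ => linStat (fun y => y ^ 2) a) (Measure.pi μ) ∧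
      ∫ a, linStat (fun y => y ^ 2) a ∂Measure.pi μ = 1 := by
  have hi : ∀ p, Integrable (fun a : UpperIndex n → ℝ => a p ^ 2) (Measure.pi μ) := fun p => by
    have : Integrable (fun x : ℝ => x ^ 2) (μ p) := by
      by_contra hcon
      have := h1 p
      rw [integral_undef hcon] at this
      exact zero_ne_one this
    exact integrable_comp_eval (μ := μ) (i := p) (f := fun x : ℝ => x ^ 2) this
  have he : ∀ p, ∫ a, a p ^ 2 ∂Measure.pi μ = 1 := fun p => by
    rw [← h1 p]
    exact integral_comp_eval (μ := μ) (i := p) (f := fun x : ℝ => x ^ 2) (by fun_prop)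
  have hn' : (n : ℝ) ≠ 0 := by exact_mod_cast hn
  simp_rw [linStat_sq]
  refine ⟨(integrable_finsetSum _ fun j _ => integrable_finsetSum _ fun k _ => hi _).div_const _, ?_⟩
  rw [integral_div, integral_finsetSum _ fun j _ => integrable_finsetSum _ fun k _ => hi _]
  simp_rw [integral_finsetSum Finset.univ fun k _ => hi _, he]
  simp only [Finset.sum_const, Finset.card_univ, Fintype.card_fin, nsmul_eq_mul, mul_one]
  field_simp

/-- The fluctuations of the statistics of the ramps of width `h`, integrated over the position of
the ramp. The squared derivative of the ramp at `x` is carried by `(x, x + h]`, so integrating the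
variance against the weight `1 + x²` gains a factor `h` over the uniform bound, and the weight
replaces a localization of the spectrum. -/
theorem lintegral_abs_linStat_ramp_sub_le {q q' : ℝ → ℝ} {B : ℝ} (hq : IsRamp q q' B) (hn : n ≠ 0)
    (μ : UpperIndex n → Measure ℝ) [∀ p, IsProbabilityMeasure (μ p)] {σ : ℝ} (hσ : 0 < σ)
    (hμ : ∀ p, PoincareInequality (μ p) (σ ^ 2)) (h1 : ∀ p, ∫ x, x ^ 2 ∂μ p = 1) {h : ℝ}
    (hh : 0 < h) (hh1 : h ≤ 1) :
    ∫⁻ x, ∫⁻ a, ENNReal.ofReal |linStat (fun y => q ((y - x) * h⁻¹)) a -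
        ∫ b, linStat (fun y => q ((y - x) * h⁻¹)) b ∂Measure.pi μ| ∂Measure.pi μ ≤
      ENNReal.ofReal ((Real.pi + 10 * B ^ 2) * (σ / (n * √h))) := by
  set ν := Measure.pi μ
  have hB := hq.pos
  have hn' : (0 : ℝ) < n := by exact_mod_cast Nat.pos_of_ne_zero hn
  set δ : ℝ := σ / (n * √h) with hδ
  have hδ0 : 0 < δ := by positivity
  set G : ℝ → (UpperIndex n → ℝ) → ℝ := fun x => linStat fun y => q ((y - x) * h⁻¹) with hG
  set D : ℝ → (UpperIndex n → ℝ) → ℝ := fun x a => spectralCDF a (x + h) - spectralCDF a x with hD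
  have hGm : ∀ x, Measurable (G x) := fun x =>
    (hq.isTestFunction_comp x h⁻¹).continuous_linStat.measurable
  have hGb : ∀ x a, |G x a| ≤ 1 := fun x a => abs_linStat_le zero_le_one (fun y => by
    rw [abs_of_nonneg (hq.nonneg _)]; exact hq.le_one _) a
  have hDi : ∀ x, Integrable (D x) ν := fun x =>
    (integrable_spectralCDF ν (x + h)).sub (integrable_spectralCDF ν x)
  have hD0 : ∀ x a, 0 ≤ D x a := fun x a => sub_nonneg.2 (spectralCDF_mono a (by linarith))
  have hderiv : ∀ x a, linStat (fun y => (q' ((y - x) * h⁻¹) * h⁻¹) ^ 2) a ≤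
      B ^ 2 / h ^ 2 * D x a := by
    intro x a
    simp only [hD, spectralCDF_eq_linStat]
    rw [sub_eq_add_neg, ← linStat_neg, ← linStat_add, ← linStat_const_mul]
    refine linStat_mono (fun y => ?_) a
    have hind : 0 ≤ (if y ≤ x + h then (1 : ℝ) else 0) + -(if y ≤ x then 1 else 0) := by
      split_ifs with h2 h3
      all_goals first | exact absurd (by linarith) h2 | norm_num
    by_cases hv : (y - x) * h⁻¹ ∈ Set.Ioc (0 : ℝ) 1
    · have h2 : ¬ y ≤ x := fun hyx => by
        have := mul_nonpos_of_nonpos_of_nonneg (sub_nonpos.2 hyx) (inv_pos.2 hh).le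
        linarith [hv.1]
      have h3 : y ≤ x + h := by
        have := hv.2
        rw [← div_eq_mul_inv, div_le_one hh] at this
        linarith
      simp only [h2, h3, if_true, if_false, neg_zero, add_zero, mul_one]
      rw [mul_pow, inv_pow, ← div_eq_mul_inv]
      refine div_le_div_of_nonneg_right (sq_le_sq' (hq.neg_le_deriv _) ?_) (sq_nonneg h)
      exact (hq.deriv_nonpos _).trans hB.le
    · rw [hq.deriv_eq_zero _ hv]
      simp only [zero_mul, ne_eq, OfNat.ofNat_ne_zero, not_false_eq_true, zero_pow]
      positivity
  set c : ℝ := 2 * σ ^ 2 / (n : ℝ) ^ 2 * (B ^ 2 / h ^ 2) / δ with hc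
  have hc0 : 0 ≤ c := by positivity
  have hin : ∀ x, ∫⁻ a, ENNReal.ofReal |G x a - ∫ b, G x b ∂ν| ∂ν ≤
      ENNReal.ofReal (δ * (1 + x ^ 2)⁻¹) +
        ENNReal.ofReal c * ∫⁻ a, ENNReal.ofReal ((1 + x ^ 2) * D x a) ∂ν := by
    intro x
    have hw : 0 < 1 + x ^ 2 := by positivity
    have hGs : Integrable (fun a => |G x a - ∫ b, G x b ∂ν|) ν :=
      ((integrable_of_bounded (hGm x) (hGb x)).sub (integrable_const _)).abs
    rw [← ofReal_integral_eq_lintegral_ofReal hGs (Eventually.of_forall fun a => abs_nonneg _),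
      ← ofReal_integral_eq_lintegral_ofReal ((hDi x).const_mul _)
        (Eventually.of_forall fun a => mul_nonneg hw.le (hD0 x a)),
      ← ENNReal.ofReal_mul hc0, ← ENNReal.ofReal_add (by positivity)
        (mul_nonneg hc0 (integral_nonneg fun a => mul_nonneg hw.le (hD0 x a)))]
    refine ENNReal.ofReal_le_ofReal ?_
    refine (integral_abs_sub_integral_le (hGm x) (hGb x)
      (show 0 < δ * (1 + x ^ 2)⁻¹ by positivity)).trans (add_le_add le_rfl ?_)
    have hvar := variance_linStat_le (hq.isTestFunction_comp x h⁻¹) μ (sq_nonneg σ) hμ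
    have hmono : ∫ a, linStat (fun y => (q' ((y - x) * h⁻¹) * h⁻¹) ^ 2) a ∂ν ≤
        B ^ 2 / h ^ 2 * ∫ a, D x a ∂ν := by
      rw [← integral_const_mul]
      refine integral_mono_of_nonneg (Eventually.of_forall fun a => ?_) ((hDi x).const_mul _)
        (Eventually.of_forall fun a => hderiv x a)
      exact div_nonneg (Finset.sum_nonneg fun _ _ => sq_nonneg _) (Nat.cast_nonneg n)
    have h3 : ∫ a, G x a ^ 2 ∂ν - (∫ a, G x a ∂ν) ^ 2 ≤
        2 * σ ^ 2 / (n : ℝ) ^ 2 * (B ^ 2 / h ^ 2 * ∫ a, D x a ∂ν) :=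
      hvar.trans (mul_le_mul_of_nonneg_left hmono (by positivity))
    rw [integral_const_mul]
    calc _ ≤ 2 * σ ^ 2 / (n : ℝ) ^ 2 * (B ^ 2 / h ^ 2 * ∫ a, D x a ∂ν) / (δ * (1 + x ^ 2)⁻¹) :=
          div_le_div_of_nonneg_right h3 (by positivity)
      _ = _ := by
          rw [hc]
          field_simp
  have hDm : Measurable (Function.uncurry fun (x : ℝ) (a : UpperIndex n → ℝ) =>
      ENNReal.ofReal ((1 + x ^ 2) * D x a)) := by
    have m1 : Measurable fun z : ℝ × (UpperIndex n → ℝ) => (z.2, z.1 + h) := by fun_prop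
    have m2 : Measurable fun z : ℝ × (UpperIndex n → ℝ) => (z.2, z.1) := by fun_prop
    have m3 := (measurable_spectralCDF (n := n)).comp m1
    have m4 := (measurable_spectralCDF (n := n)).comp m2
    have m5 : Measurable fun z : ℝ × (UpperIndex n → ℝ) => 1 + z.1 ^ 2 := by fun_prop
    have m6 := (m5.mul (m3.sub m4)).ennreal_ofReal
    simp only [Function.comp_def] at m6
    exact m6
  have hsecond : ∫⁻ x, ∫⁻ a, ENNReal.ofReal ((1 + x ^ 2) * D x a) ∂ν ≤ ENNReal.ofReal (h * 5) := by
    rw [lintegral_lintegral_swap hDm.aemeasurable]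
    have hwin : ∀ a, ∫⁻ x, ENNReal.ofReal ((1 + x ^ 2) * D x a) ≤
        ENNReal.ofReal (h * (3 + 2 * linStat (fun y => y ^ 2) a)) := by
      intro a
      have := lintegral_weight_mul_window_le (w := fun x => 1 + x ^ 2) (M := fun y => 3 + 2 * y ^ 2)
        hh.le (fun x y hy => by
          have h2 : (y - x) ^ 2 ≤ 1 := by
            have h3 : 0 ≤ y - x := by linarith [hy.1]
            have h4 : y - x ≤ 1 := by linarith [hy.2]
            nlinarith
          nlinarith [sq_nonneg (x - 2 * y)]) (fun y => by positivity) a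
      rwa [linStat_add (fun _ => 3), linStat_const hn, linStat_const_mul] at this
    refine (lintegral_mono hwin).trans ?_
    obtain ⟨hi, he⟩ := integrable_linStat_sq hn μ h1
    have hi2 : Integrable (fun a => h * (3 + 2 * linStat (fun y => y ^ 2) a)) ν :=
      ((integrable_const _).add (hi.const_mul 2)).const_mul h
    rw [← ofReal_integral_eq_lintegral_ofReal hi2 (Eventually.of_forall fun a => by
      have : 0 ≤ linStat (fun y => y ^ 2) a :=
        div_nonneg (Finset.sum_nonneg fun _ _ => sq_nonneg _) (Nat.cast_nonneg n)
      simp only [Pi.zero_apply]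
      positivity)]
    refine ENNReal.ofReal_le_ofReal (le_of_eq ?_)
    rw [integral_const_mul, integral_add (integrable_const _) (hi.const_mul 2), integral_const_mul, he]
    simp only [integral_const, probReal_univ, one_smul]
    norm_num
  refine (lintegral_mono hin).trans ?_
  rw [lintegral_add_left (by fun_prop), lintegral_const_mul _ hDm.lintegral_prod_right]
  have hfirst : ∫⁻ x : ℝ, ENNReal.ofReal (δ * (1 + x ^ 2)⁻¹) = ENNReal.ofReal (δ * Real.pi) := by
    rw [← ofReal_integral_eq_lintegral_ofReal (integrable_inv_one_add_sq.const_mul δ)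
      (Eventually.of_forall fun x => by simp only [Pi.zero_apply]; positivity), integral_const_mul,
      integral_univ_inv_one_add_sq]
  rw [hfirst]
  refine (add_le_add le_rfl (mul_le_mul_right hsecond _)).trans ?_
  rw [← ENNReal.ofReal_mul hc0, ← ENNReal.ofReal_add (by positivity) (by positivity)]
  refine ENNReal.ofReal_le_ofReal (le_of_eq ?_)
  have hsq : √h ^ 2 = h := Real.sq_sqrt hh.le
  have hcδ : c * (h * 5) = 10 * B ^ 2 * δ := by
    have h2 : δ ^ 2 = σ ^ 2 / (n ^ 2 * h) := by rw [hδ, div_pow, mul_pow, hsq]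
    have h3 : σ ^ 2 = δ ^ 2 * (n ^ 2 * h) := by rw [h2]; field_simp
    rw [hc, h3]
    field_simp
    ring
  rw [hcδ]
  ring

theorem lintegral_kantorovichDist_spectralCDF_le {q q' : ℝ → ℝ} {B : ℝ} (hq : IsRamp q q' B)
    (hn : n ≠ 0) (μ : UpperIndex n → Measure ℝ) [∀ p, IsProbabilityMeasure (μ p)] {σ : ℝ}
    (hσ : 1 ≤ σ) (hμ : ∀ p, PoincareInequality (μ p) (σ ^ 2)) (h1 : ∀ p, ∫ x, x ^ 2 ∂μ p = 1) :
    ∫⁻ a, kantorovichDist (spectralCDF a) (fun x => ∫ b, spectralCDF b x ∂Measure.pi μ)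
        ∂Measure.pi μ ≤
      ENNReal.ofReal ((Real.pi + 10 * B ^ 2 + 2) * σ / (n : ℝ) ^ (2 / 3 : ℝ)) := by
  set ν := Measure.pi μ with hν
  have hn' : (1 : ℝ) ≤ n := by exact_mod_cast Nat.one_le_iff_ne_zero.2 hn
  have hn0 : (0 : ℝ) < n := by linarith
  -- With `h = n^(-2/3)` the width `h` and the fluctuation bound `σ / (n √h)` are of the same order.
  set h : ℝ := (n : ℝ) ^ (-(2 / 3) : ℝ) with hh
  have hh0 : 0 < h := Real.rpow_pos_of_pos hn0 _
  have hh1 : h ≤ 1 := Real.rpow_le_one_of_one_le_of_nonpos hn' (by norm_num)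
  have hhs : (n : ℝ) * √h = (n : ℝ) ^ (2 / 3 : ℝ) := by
    rw [Real.sqrt_eq_rpow, hh, ← Real.rpow_mul hn0.le]
    nth_rewrite 1 [← Real.rpow_one (n : ℝ)]
    rw [← Real.rpow_add hn0]
    norm_num
  have hhi : h = 1 / (n : ℝ) ^ (2 / 3 : ℝ) := by
    rw [hh, Real.rpow_neg hn0.le, one_div]
  set G : ℝ → (UpperIndex n → ℝ) → ℝ := fun x => linStat fun y => q ((y - x) * h⁻¹) with hG
  set F : ℝ → ℝ := fun x => ∫ b, spectralCDF b x ∂ν with hF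
  have hGm : Measurable (Function.uncurry G) := by
    have hs : Measurable (Prod.swap : ℝ × (UpperIndex n → ℝ) → (UpperIndex n → ℝ) × ℝ) :=
      measurable_swap
    have h2 := (hq.measurable_linStat (n := n) h⁻¹).comp hs
    simp only [Function.comp_def, Prod.fst_swap, Prod.snd_swap] at h2
    exact h2
  have hGb : ∀ x a, |G x a| ≤ 1 := fun x a => abs_linStat_le zero_le_one (fun y => by
    rw [abs_of_nonneg (hq.nonneg _)]; exact hq.le_one _) a
  have hGi : ∀ x, Integrable (G x) ν := fun x =>
    integrable_of_bounded (hq.isTestFunction_comp x h⁻¹).continuous_linStat.measurable (hGb x)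
  have hlow : ∀ x a, spectralCDF a x ≤ G x a := fun x a => by
    rw [spectralCDF_eq_linStat]
    refine linStat_mono (fun y => ?_) a
    split_ifs with hy
    · rw [hq.eq_one _ (mul_nonpos_of_nonpos_of_nonneg (by linarith) (inv_pos.2 hh0).le)]
    · exact hq.nonneg _
  have hupp : ∀ x a, G x a ≤ spectralCDF a (x + h) := fun x a => by
    rw [spectralCDF_eq_linStat]
    refine linStat_mono (fun y => ?_) a
    split_ifs with hy
    · exact hq.le_one _
    · rw [hq.eq_zero]
      rw [← div_eq_mul_inv, le_div_iff₀ hh0]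
      linarith [not_le.1 hy]
  have hFm' : Measurable (Function.uncurry fun (x : ℝ) (a : UpperIndex n → ℝ) => spectralCDF a x) := by
    have hs : Measurable (Prod.swap : ℝ × (UpperIndex n → ℝ) → (UpperIndex n → ℝ) × ℝ) :=
      measurable_swap
    have h2 := (measurable_spectralCDF (n := n)).comp hs
    simp only [Function.comp_def, Prod.fst_swap, Prod.snd_swap] at h2
    exact h2
  have hGav : Measurable fun x => ∫ b, G x b ∂ν :=
    hGm.stronglyMeasurable.integral_prod_right.measurable
  have hm1 : Measurable (Function.uncurry fun (x : ℝ) (a : UpperIndex n → ℝ) =>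
      ENNReal.ofReal (G x a - spectralCDF a x)) := (hGm.sub hFm').ennreal_ofReal
  have hm2 : Measurable (Function.uncurry fun (x : ℝ) (a : UpperIndex n → ℝ) =>
      ENNReal.ofReal |G x a - ∫ b, G x b ∂ν|) :=
    (continuous_abs.measurable.comp (hGm.sub (hGav.comp measurable_fst))).ennreal_ofReal
  have hwin : ∀ a, ∫⁻ x, ENNReal.ofReal (G x a - spectralCDF a x) ≤ ENNReal.ofReal h := by
    intro a
    have := lintegral_weight_mul_window_le (w := fun _ => 1) (M := fun _ => 1) hh0.le
      (fun _ _ _ => le_rfl) (fun _ => zero_le_one) a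
    rw [linStat_const hn, mul_one] at this
    refine (lintegral_mono fun x => ENNReal.ofReal_le_ofReal ?_).trans this
    rw [one_mul]
    exact sub_le_sub_right (hupp x a) _
  have hbias : ∫⁻ x, ENNReal.ofReal (∫ a, G x a ∂ν - F x) ≤ ENNReal.ofReal h := by
    have e : ∀ x, ENNReal.ofReal (∫ a, G x a ∂ν - F x) =
        ∫⁻ a, ENNReal.ofReal (G x a - spectralCDF a x) ∂ν := fun x => by
      rw [hF, ← integral_sub (hGi x) (integrable_spectralCDF ν x)]
      exact ofReal_integral_eq_lintegral_ofReal ((hGi x).sub (integrable_spectralCDF ν x))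
        (Eventually.of_forall fun a => sub_nonneg.2 (hlow x a))
    simp_rw [e]
    rw [lintegral_lintegral_swap hm1.aemeasurable]
    refine (lintegral_mono hwin).trans ?_
    simp
  have hpt : ∀ a x, ENNReal.ofReal |spectralCDF a x - F x| ≤
      ENNReal.ofReal (G x a - spectralCDF a x) + (ENNReal.ofReal |G x a - ∫ b, G x b ∂ν| +
        ENNReal.ofReal (∫ b, G x b ∂ν - F x)) := fun a x => by
    have hFG : F x ≤ ∫ b, G x b ∂ν := integral_mono (integrable_spectralCDF ν x) (hGi x) (hlow x)
    rw [← ENNReal.ofReal_add (abs_nonneg _) (sub_nonneg.2 hFG),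
      ← ENNReal.ofReal_add (sub_nonneg.2 (hlow x a)) (add_nonneg (abs_nonneg _) (sub_nonneg.2 hFG))]
    refine ENNReal.ofReal_le_ofReal ?_
    have h2 := hlow x a
    rw [abs_le]
    constructor <;> cases abs_cases (G x a - ∫ b, G x b ∂ν) <;> linarith
  have hbound : ∀ a, kantorovichDist (spectralCDF a) F ≤ ENNReal.ofReal h +
      ((∫⁻ x, ENNReal.ofReal |G x a - ∫ b, G x b ∂ν|) + ENNReal.ofReal h) := fun a => by
    have ha : Measurable fun x : ℝ => (x, a) := measurable_prodMk_right
    refine (lintegral_mono (hpt a)).trans ?_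
    have m1 : Measurable fun x => ENNReal.ofReal (G x a - spectralCDF a x) := by
      have := hm1.comp ha
      simpa only [Function.comp_def, Function.uncurry_apply_pair] using this
    have m2 : Measurable fun x => ENNReal.ofReal |G x a - ∫ b, G x b ∂ν| := by
      have := hm2.comp ha
      simpa only [Function.comp_def, Function.uncurry_apply_pair] using this
    rw [lintegral_add_left m1, lintegral_add_left m2]
    exact add_le_add (hwin a) (add_le_add le_rfl hbias)
  refine (lintegral_mono hbound).trans ?_
  rw [lintegral_add_left measurable_const, lintegral_add_right _ measurable_const, lintegral_const,
    measure_univ, mul_one, ← lintegral_lintegral_swap hm2.aemeasurable]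
  refine (add_le_add le_rfl (add_le_add (lintegral_abs_linStat_ramp_sub_le hq hn μ (by linarith) hμ
    h1 hh0 hh1) le_rfl)).trans ?_
  have hB := hq.pos
  rw [← ENNReal.ofReal_add (by positivity) hh0.le, ← ENNReal.ofReal_add hh0.le (by positivity), hhs]
  refine ENNReal.ofReal_le_ofReal ?_
  rw [hhi]
  have hN : 0 < (n : ℝ) ^ (2 / 3 : ℝ) := Real.rpow_pos_of_pos hn0 _
  have h3 : 1 / (n : ℝ) ^ (2 / 3 : ℝ) ≤ σ / (n : ℝ) ^ (2 / 3 : ℝ) :=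
    div_le_div_of_nonneg_right hσ hN.le
  have e : (Real.pi + 10 * B ^ 2 + 2) * σ / (n : ℝ) ^ (2 / 3 : ℝ) =
      (Real.pi + 10 * B ^ 2) * (σ / (n : ℝ) ^ (2 / 3 : ℝ)) + 2 * (σ / (n : ℝ) ^ (2 / 3 : ℝ)) := by ring
  rw [e]
  linarith

end Kantorovich

/-! ### The mean Kolmogorov distance to the semicircle law -/

section Semicircle

open Filter Topology

/-- The density of the semicircle law. -/
def semicircleDensity (t : ℝ) : ℝ :=
  (Set.Icc (-2 : ℝ) 2).indicator (fun t => √(4 - t ^ 2) / (2 * Real.pi)) t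

theorem semicircleDensity_nonneg (t : ℝ) : 0 ≤ semicircleDensity t :=
  Set.indicator_nonneg (fun _ _ => by positivity) _

theorem semicircleDensity_le_one (t : ℝ) : semicircleDensity t ≤ 1 := by
  unfold semicircleDensity
  refine Set.indicator_apply_le' (fun _ => ?_) fun _ => zero_le_one
  rw [div_le_one (by positivity)]
  have h1 : √(4 - t ^ 2) ≤ 2 := Real.sqrt_le_iff.2 ⟨by norm_num, by nlinarith [sq_nonneg t]⟩
  linarith [Real.pi_gt_three]

theorem integrable_semicircleDensity : Integrable semicircleDensity := by
  have : IntegrableOn (fun t : ℝ => √(4 - t ^ 2) / (2 * Real.pi)) (Set.Icc (-2) 2) :=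
    (Continuous.continuousOn (by fun_prop)).integrableOn_compact isCompact_Icc
  exact this.integrable_indicator measurableSet_Icc

theorem integral_semicircleDensity : ∫ t, semicircleDensity t = 1 := by
  have h1 : ∫ t, semicircleDensity t = ∫ t in (-2 : ℝ)..2, √(4 - t ^ 2) / (2 * Real.pi) := by
    unfold semicircleDensity
    rw [integral_indicator measurableSet_Icc, integral_Icc_eq_integral_Ioc,
      intervalIntegral.integral_of_le (by norm_num)]
  have h2 : ∫ t in (-2 : ℝ)..2, √(4 - t ^ 2) = 2 * Real.pi := by
    have h3 := intervalIntegral.integral_comp_mul_left (a := -1) (b := 1)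
      (fun t : ℝ => √(4 - t ^ 2)) (c := 2) two_ne_zero
    have h4 : ∀ t : ℝ, √(4 - (2 * t) ^ 2) = 2 * √(1 - t ^ 2) := fun t => by
      rw [show 4 - (2 * t) ^ 2 = 2 ^ 2 * (1 - t ^ 2) by ring, Real.sqrt_mul (by norm_num),
        Real.sqrt_sq (by norm_num)]
    simp_rw [h4] at h3
    rw [intervalIntegral.integral_const_mul, integral_sqrt_one_sub_sq] at h3
    norm_num at h3
    linarith
  rw [h1, intervalIntegral.integral_div, h2, div_self (by positivity)]

theorem semicircleCDF_eq (x : ℝ) : semicircleCDF x = ∫ t in Set.Iic x, semicircleDensity t := rfl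

theorem semicircleCDF_sub (x y : ℝ) :
    semicircleCDF y - semicircleCDF x = ∫ t in x..y, semicircleDensity t :=
  intervalIntegral.integral_Iic_sub_Iic integrable_semicircleDensity.integrableOn
    integrable_semicircleDensity.integrableOn

theorem semicircleCDF_mono : Monotone semicircleCDF := fun x y h => by
  rw [← sub_nonneg, semicircleCDF_sub]
  exact intervalIntegral.integral_nonneg h fun t _ => semicircleDensity_nonneg t

theorem semicircleCDF_le_add {x y : ℝ} (h : x ≤ y) :
    semicircleCDF y ≤ semicircleCDF x + (y - x) := by
  rw [← sub_le_iff_le_add', semicircleCDF_sub]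
  have := intervalIntegral.integral_mono_on h integrable_semicircleDensity.intervalIntegrable
    (intervalIntegrable_const (c := (1 : ℝ))) fun t _ => semicircleDensity_le_one t
  simpa using this

theorem semicircleCDF_of_le {x : ℝ} (h : x ≤ -2) : semicircleCDF x = 0 := by
  rw [semicircleCDF_eq, integral_Iic_eq_integral_Iio]
  refine setIntegral_eq_zero_of_forall_eq_zero fun t ht => ?_
  unfold semicircleDensity
  rw [Set.indicator_of_notMem]
  intro hmem
  have : t < x := ht
  linarith [hmem.1]

theorem semicircleCDF_of_ge {x : ℝ} (h : 2 ≤ x) : semicircleCDF x = 1 := by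
  rw [semicircleCDF_eq, ← integral_semicircleDensity, ← integral_indicator measurableSet_Iic]
  congr 1
  ext t
  by_cases ht : t ≤ x
  · rw [Set.indicator_of_mem (Set.mem_Iic.2 ht)]
  · rw [Set.indicator_of_notMem (Set.mem_Iic.not.2 ht)]
    unfold semicircleDensity
    rw [Set.indicator_of_notMem]
    intro hmem
    exact ht (hmem.2.trans h)

theorem semicircleCDF_nonneg (x : ℝ) : 0 ≤ semicircleCDF x := by
  rw [← semicircleCDF_of_le (min_le_right x (-2))]; exact semicircleCDF_mono (min_le_left _ _)

theorem semicircleCDF_le_one (x : ℝ) : semicircleCDF x ≤ 1 := by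
  rw [← semicircleCDF_of_ge (le_max_right x 2)]; exact semicircleCDF_mono (le_max_left _ _)

end Semicircle

section Kolmogorov

open Filter Topology

variable {n : ℕ}

/-- Comparison of a distribution function with the semicircle law on a grid of `[-2, 2]` controls
the Kolmogorov distance up to the mesh. -/
theorem abs_sub_semicircleCDF_le {F : ℝ → ℝ} (hF : Monotone F) (h0 : ∀ x, 0 ≤ F x)
    (h1 : ∀ x, F x ≤ 1) (hn : n ≠ 0) {E : ℝ}
    (hu : ∀ i ∈ Finset.range (n + 1), F (-2 + 4 * i / n) - semicircleCDF (-2 + 4 * i / n) ≤ E)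
    (hl : ∀ i ∈ Finset.range (n + 1), semicircleCDF (-2 + 4 * i / n) - F (-2 + 4 * i / n) ≤ E)
    (x : ℝ) : |F x - semicircleCDF x| ≤ E + 4 / n := by
  have hn0 : (0 : ℝ) < n := by exact_mod_cast Nat.pos_of_ne_zero hn
  have hmesh : (0 : ℝ) < 4 / n := by positivity
  have a0 := hu 0 (by simp)
  have b1 := hl n (by simp)
  rw [mul_div_cancel_right₀ _ hn0.ne', show (-2 : ℝ) + 4 = 2 by norm_num,
    semicircleCDF_of_ge le_rfl] at b1
  simp only [Nat.cast_zero, mul_zero, zero_div, add_zero] at a0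
  rw [semicircleCDF_of_le le_rfl] at a0
  have hE : 0 ≤ E := by linarith [h0 (-2)]
  rw [abs_le]
  rcases lt_or_ge x (-2) with hx | hx
  · rw [semicircleCDF_of_le hx.le]
    constructor <;> linarith [h0 x, hF hx.le]
  rcases le_or_gt 2 x with hx2 | hx2
  · rw [semicircleCDF_of_ge hx2]
    constructor <;> linarith [h1 x, hF hx2]
  set i := ⌊(x + 2) * n / 4⌋₊ with hi
  have hpos : 0 ≤ (x + 2) * n / 4 := by
    have : 0 ≤ x + 2 := by linarith
    positivity
  have hi1 : (i : ℝ) ≤ (x + 2) * n / 4 := Nat.floor_le hpos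
  have hi2 : (x + 2) * n / 4 < i + 1 := Nat.lt_floor_add_one _
  have hin : i < n := by
    have : (x + 2) * n / 4 < n := by nlinarith
    exact_mod_cast hi1.trans_lt this
  have hx1 : -2 + 4 * (i : ℝ) / n ≤ x := by
    have : 4 * (i : ℝ) / n ≤ x + 2 := by rw [div_le_iff₀ hn0]; linarith
    linarith
  have hx3 : x ≤ -2 + 4 * ((i + 1 : ℕ) : ℝ) / n := by
    have : x + 2 ≤ 4 * ((i + 1 : ℕ) : ℝ) / n := by
      rw [le_div_iff₀ hn0]; push_cast; linarith
    linarith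
  have hdiff : -2 + 4 * ((i + 1 : ℕ) : ℝ) / n = (-2 + 4 * (i : ℝ) / n) + 4 / n := by
    push_cast; ring
  have hGu := semicircleCDF_le_add hx3
  have hGl := semicircleCDF_le_add hx1
  have e1 := hu (i + 1) (by simp; omega)
  have e2 := hl i (by simp; omega)
  constructor
  · linarith [hF hx1]
  · linarith [hF hx3]

/-- Exponential moments of the ramp statistics at `x` on both sides of `Fₙ(x)`, compared with the
semicircle law. The ramp is moved a distance `B h` while the exponent grows from `0` to
`T = log n / h`; this speed is what the Hamilton–Jacobi condition asks for a slope `B / h`. The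
motion only costs the increment of the semicircle law over a distance of order `h`, so that the
distance `D` between the mean and the semicircle law enters with constant one. -/
theorem integral_exp_ramp_le {q q' : ℝ → ℝ} {B : ℝ} (hq : IsRamp q q' B)
    (μ : UpperIndex n → Measure ℝ) [∀ p, IsProbabilityMeasure (μ p)] {c h ℓ D : ℝ} (hc : 0 ≤ c)
    (hμ : ∀ p, LogSobolevInequality (μ p) c) (hh : 0 < h) (hℓ : 0 < ℓ)
    (hhc : h ^ 3 = c / (n : ℝ) ^ 2 * ℓ)
    (hD : ∀ x, |(∫ b, spectralCDF b x ∂Measure.pi μ) - semicircleCDF x| ≤ D) (x : ℝ) :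
    ∫ a, Real.exp (ℓ / h * (linStat (fun y => q ((y - x) * h⁻¹)) a - semicircleCDF x))
        ∂Measure.pi μ ≤ Real.exp (ℓ / h * ((B + 1) * h + D)) ∧
      ∫ a, Real.exp (ℓ / h * (semicircleCDF x - linStat (fun y => q ((y - (x - h)) * h⁻¹)) a))
        ∂Measure.pi μ ≤ Real.exp (ℓ / h * ((B + 1) * h + D)) := by
  set ν := Measure.pi μ
  have hB := hq.pos
  have hT : 0 < ℓ / h := by positivity
  set r : ℝ := B * h ^ 2 / ℓ with hr
  have hrT : r * (ℓ / h) = B * h := by rw [hr]; field_simp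
  have hspeed : ∀ v, 0 ≤ c / (n : ℝ) ^ 2 * (q' v * h⁻¹) + r := fun v => by
    have h1 : r = c / (n : ℝ) ^ 2 * (B * h⁻¹) := by
      have : c / (n : ℝ) ^ 2 = h ^ 3 / ℓ := by rw [hhc]; field_simp
      rw [this, hr]; field_simp
    have h2 : 0 ≤ c / (n : ℝ) ^ 2 * ((q' v + B) * h⁻¹) := by
      have := hq.neg_le_deriv v
      have : 0 ≤ q' v + B := by linarith
      positivity
    rw [h1]; linarith
  have hslope : ∀ v, q' v * h⁻¹ ≤ 0 := fun v =>
    mul_nonpos_of_nonpos_of_nonneg (hq.deriv_nonpos v) (inv_pos.2 hh).le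
  have hsi : ∀ z, Integrable (linStat (n := n) fun y => q ((y - z) * h⁻¹)) ν := fun z =>
    integrable_of_bounded (hq.isTestFunction_comp z h⁻¹).continuous_linStat.measurable
      (C := 1) fun a => abs_linStat_le zero_le_one (fun y => by
        rw [abs_of_nonneg (hq.nonneg _)]; exact hq.le_one _) a
  have hupp : ∀ z, ∫ a, linStat (fun y => q ((y - z) * h⁻¹)) a ∂ν ≤
      ∫ b, spectralCDF b (z + h) ∂ν := fun z => by
    refine integral_mono (hsi z) (integrable_spectralCDF ν _) fun a => ?_
    dsimp only
    rw [spectralCDF_eq_linStat]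
    refine linStat_mono (fun y => ?_) a
    split_ifs with hy
    · exact hq.le_one _
    · rw [hq.eq_zero]
      rw [← div_eq_mul_inv, le_div_iff₀ hh]
      linarith [not_le.1 hy]
  have hlow : ∀ z, ∫ b, spectralCDF b z ∂ν ≤ ∫ a, linStat (fun y => q ((y - z) * h⁻¹)) a ∂ν :=
    fun z => by
    refine integral_mono (integrable_spectralCDF ν _) (hsi z) fun a => ?_
    dsimp only
    rw [spectralCDF_eq_linStat]
    refine linStat_mono (fun y => ?_) a
    split_ifs with hy
    · rw [hq.eq_one _ (mul_nonpos_of_nonpos_of_nonneg (by linarith) (inv_pos.2 hh).le)]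
    · exact hq.nonneg _
  constructor
  · have key := integral_exp_linStat_le (hq.isTestFunction_comp (x + B * h) h⁻¹) μ hc hμ (r := r)
      (fun y => by
        have := mul_nonpos_of_nonneg_of_nonpos (hspeed ((y - (x + B * h)) * h⁻¹))
          (hslope ((y - (x + B * h)) * h⁻¹))
        linarith) hT
    rw [hrT] at key
    simp only [add_sub_add_right_eq_sub] at key
    simp_rw [mul_sub, Real.exp_sub]
    rw [integral_div, div_le_iff₀ (Real.exp_pos _), ← Real.exp_add, ← mul_add]
    refine key.trans (Real.exp_le_exp.2 (mul_le_mul_of_nonneg_left ?_ hT.le))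
    refine (hupp _).trans ?_
    have h1 := (abs_le.1 (hD (x + B * h + h))).2
    have h2 := semicircleCDF_le_add (show x ≤ x + B * h + h by nlinarith)
    linarith
  · have key := integral_exp_linStat_le (hq.isTestFunction_comp (x - h - B * h) h⁻¹).neg μ hc hμ
      (r := -r) (fun y => by
        have := mul_nonpos_of_nonneg_of_nonpos (hspeed ((y - (x - h - B * h)) * h⁻¹))
          (hslope ((y - (x - h - B * h)) * h⁻¹))
        linarith) hT
    rw [neg_mul, hrT] at key
    have e1 : ∀ y, y + -(B * h) - (x - h - B * h) = y - (x - h) := fun y => by ring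
    simp only [e1, linStat_neg, integral_neg] at key
    have e2 : ∀ a : UpperIndex n → ℝ,
        Real.exp (ℓ / h * (semicircleCDF x - linStat (fun y => q ((y - (x - h)) * h⁻¹)) a)) =
        Real.exp (ℓ / h * semicircleCDF x) *
          Real.exp (ℓ / h * -linStat (fun y => q ((y - (x - h)) * h⁻¹)) a) := fun a => by
      rw [← Real.exp_add]; congr 1; ring
    simp_rw [e2]
    rw [integral_const_mul]
    refine (mul_le_mul_of_nonneg_left key (Real.exp_pos _).le).trans ?_
    rw [← Real.exp_add, ← mul_add]
    refine Real.exp_le_exp.2 (mul_le_mul_of_nonneg_left ?_ hT.le)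
    have h1 := (abs_le.1 (hD (x - h - B * h))).1
    have h2 := semicircleCDF_le_add (show x - h - B * h ≤ x by nlinarith)
    have h3 := hlow (x - h - B * h)
    linarith

/-- The mean Kolmogorov distance to the semicircle law, in terms of `h = (c n⁻² log n)^(1/3)`: the
distance is bounded by a measurable function of the entries whose mean is `D + O(h)`. -/
theorem exists_kolmogorovDist_spectralCDF_le {q q' : ℝ → ℝ} {B : ℝ} (hq : IsRamp q q' B)
    (hn : 2 ≤ n) (μ : UpperIndex n → Measure ℝ) [∀ p, IsProbabilityMeasure (μ p)] {c h D : ℝ}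
    (hc : 1 ≤ 2 * c) (hμ : ∀ p, LogSobolevInequality (μ p) c) (hh : 0 < h)
    (hhc : h ^ 3 = c / (n : ℝ) ^ 2 * Real.log n)
    (hD : ∀ x, |(∫ b, spectralCDF b x ∂Measure.pi μ) - semicircleCDF x| ≤ D) :
    ∃ Φ : (UpperIndex n → ℝ) → ℝ≥0∞, Measurable Φ ∧
      (∀ a, kolmogorovDist (spectralCDF a) semicircleCDF ≤ Φ a) ∧
      ∫⁻ a, Φ a ∂Measure.pi μ ≤ ENNReal.ofReal ((B + 12) * h + D) := by
  set ν := Measure.pi μ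
  have hB := hq.pos
  have hn2 : (2 : ℝ) ≤ n := by exact_mod_cast hn
  have hn0 : (0 : ℝ) < n := by linarith
  have hn' : n ≠ 0 := by omega
  set ℓ := Real.log n with hℓ
  have hℓ0 : 0 < ℓ := Real.log_pos (by linarith)
  have hℓ2 : 0.69 < ℓ := by
    have := Real.log_le_log (by norm_num) hn2
    linarith [Real.log_two_gt_d9]
  set T := ℓ / h with hT
  have hT0 : 0 < T := by positivity
  let x : ℕ → ℝ := fun i => -2 + 4 * i / n
  let U : ℕ → (UpperIndex n → ℝ) → ℝ := fun i a =>
    linStat (fun y => q ((y - x i) * h⁻¹)) a - semicircleCDF (x i)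
  let V : ℕ → (UpperIndex n → ℝ) → ℝ := fun i a =>
    semicircleCDF (x i) - linStat (fun y => q ((y - (x i - h)) * h⁻¹)) a
  have hUc : ∀ i, Continuous (U i) := fun i =>
    (hq.isTestFunction_comp (x i) h⁻¹).continuous_linStat.sub continuous_const
  have hVc : ∀ i, Continuous (V i) := fun i =>
    continuous_const.sub (hq.isTestFunction_comp (x i - h) h⁻¹).continuous_linStat
  have hS : ∀ z (a : UpperIndex n → ℝ), |linStat (fun y => q ((y - z) * h⁻¹)) a| ≤ 1 := fun z a =>
    abs_linStat_le zero_le_one (fun y => by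
      rw [abs_of_nonneg (hq.nonneg _)]; exact hq.le_one _) a
  have hU2 : ∀ i a, U i a ≤ 2 := fun i a => by
    have h1 := (abs_le.1 (hS (x i) a)).2
    have h2 := semicircleCDF_nonneg (x i)
    simp only [U]; linarith
  have hV2 : ∀ i a, V i a ≤ 2 := fun i a => by
    have h1 := (abs_le.1 (hS (x i - h) a)).1
    have h2 := semicircleCDF_le_one (x i)
    simp only [V]; linarith
  set M : ℝ := T * ((B + 1) * h + D) with hM
  set β : ℝ := M + Real.log (2 * (n + 1)) with hβ
  let S : (UpperIndex n → ℝ) → ℝ := fun a =>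
    ∑ i ∈ Finset.range (n + 1), (Real.exp (T * U i a) + Real.exp (T * V i a))
  -- `t ≤ β - 1 + exp(t - β)` replaces the logarithm of the exponential moment of the maximum.
  let E : (UpperIndex n → ℝ) → ℝ := fun a => (β - 1 + Real.exp (-β) * S a) / T
  have hexpi : ∀ {u : (UpperIndex n → ℝ) → ℝ}, Continuous u → (∀ a, u a ≤ 2) →
      Integrable (fun a => Real.exp (T * u a)) ν := fun hu hu2 =>
    integrable_of_bounded (C := Real.exp (T * 2)) (by fun_prop) fun a => by
      rw [Real.abs_exp]
      exact Real.exp_le_exp.2 (mul_le_mul_of_nonneg_left (hu2 a) hT0.le)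
  have hSi : Integrable S ν := integrable_finsetSum _ fun i _ =>
    (hexpi (hUc i) (hU2 i)).add (hexpi (hVc i) (hV2 i))
  have hSint : ∫ a, S a ∂ν ≤ 2 * (n + 1) * Real.exp M := by
    have hterm_int : ∀ i ∈ Finset.range (n + 1),
        Integrable (fun a => Real.exp (T * U i a) + Real.exp (T * V i a)) ν := fun i _ =>
      (hexpi (hUc i) (hU2 i)).add (hexpi (hVc i) (hV2 i))
    simp only [S]
    rw [integral_finsetSum _ hterm_int]
    have hterm : ∀ i ∈ Finset.range (n + 1),
        ∫ a, (Real.exp (T * U i a) + Real.exp (T * V i a)) ∂ν ≤ 2 * Real.exp M := fun i _ => by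
      rw [integral_add (hexpi (hUc i) (hU2 i)) (hexpi (hVc i) (hV2 i)), two_mul]
      obtain ⟨h1, h2⟩ := integral_exp_ramp_le hq μ (by linarith) hμ hh hℓ0 hhc hD (x i)
      exact add_le_add h1 h2
    refine (Finset.sum_le_sum hterm).trans (le_of_eq ?_)
    rw [Finset.sum_const, Finset.card_range, nsmul_eq_mul]
    push_cast
    ring
  have hEi : Integrable E ν := ((integrable_const _).add (hSi.const_mul _)).div_const T
  have hcard : (0 : ℝ) < 2 * (n + 1) := by positivity
  have hEint : ∫ a, E a ∂ν ≤ (B + 4) * h + D := by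
    simp only [E]
    rw [integral_div, integral_add (integrable_const _) (hSi.const_mul _), integral_const_mul]
    simp only [integral_const, probReal_univ, one_smul]
    have h1 : Real.exp (-β) * ∫ a, S a ∂ν ≤ 1 := by
      refine (mul_le_mul_of_nonneg_left hSint (Real.exp_pos _).le).trans (le_of_eq ?_)
      rw [hβ, neg_add, Real.exp_add, Real.exp_neg, Real.exp_neg, Real.exp_log hcard]
      have := (Real.exp_pos M).ne'
      field_simp
    have h2 : Real.log (2 * (n + 1)) ≤ 3 * ℓ := by
      rw [hℓ, ← Real.log_rpow hn0]
      refine Real.log_le_log hcard ?_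
      have : (n : ℝ) ^ (3 : ℝ) = (n : ℝ) ^ 3 := by exact_mod_cast Real.rpow_natCast (n : ℝ) 3
      rw [this]
      nlinarith [mul_le_mul hn2 hn2 zero_le_two hn0.le]
    rw [div_le_iff₀ hT0]
    have h3 : T * h = ℓ := by rw [hT]; field_simp
    calc β - 1 + Real.exp (-β) * ∫ a, S a ∂ν ≤ M + 3 * ℓ := by linarith
      _ = ((B + 4) * h + D) * T := by rw [hM, ← h3]; ring
  have hmax : ∀ a (t : ℝ), Real.exp (T * t) ≤ S a → t ≤ E a := fun a t ht => by
    have h1 := Real.add_one_le_exp (T * t - β)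
    have h2 : Real.exp (T * t - β) ≤ Real.exp (-β) * S a := by
      rw [sub_eq_neg_add, Real.exp_add]
      exact mul_le_mul_of_nonneg_left ht (Real.exp_pos _).le
    rw [le_div_iff₀ hT0]
    linarith
  have hUE : ∀ a, ∀ i ∈ Finset.range (n + 1), U i a ≤ E a := fun a i hi => hmax a _
    (le_trans (by linarith [Real.exp_pos (T * V i a)]) (Finset.single_le_sum
      (f := fun i => Real.exp (T * U i a) + Real.exp (T * V i a)) (fun j _ => by positivity) hi))
  have hVE : ∀ a, ∀ i ∈ Finset.range (n + 1), V i a ≤ E a := fun a i hi => hmax a _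
    (le_trans (by linarith [Real.exp_pos (T * U i a)]) (Finset.single_le_sum
      (f := fun i => Real.exp (T * U i a) + Real.exp (T * V i a)) (fun j _ => by positivity) hi))
  have hdist : ∀ a z, |spectralCDF a z - semicircleCDF z| ≤ E a + 4 / n := fun a z => by
    refine abs_sub_semicircleCDF_le (spectralCDF_mono a) (spectralCDF_nonneg a)
      (spectralCDF_le_one a) hn' (fun i hi => ?_) (fun i hi => ?_) z
    · refine le_trans (sub_le_sub_right ?_ _) (hUE a i hi)
      rw [spectralCDF_eq_linStat]
      refine linStat_mono (fun y => ?_) a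
      split_ifs with hy
      · rw [hq.eq_one _ (mul_nonpos_of_nonpos_of_nonneg (sub_nonpos.2 hy) (inv_pos.2 hh).le)]
      · exact hq.nonneg _
    · refine le_trans (sub_le_sub_left ?_ _) (hVE a i hi)
      rw [spectralCDF_eq_linStat]
      refine linStat_mono (fun y => ?_) a
      split_ifs with hy
      · exact hq.le_one _
      · rw [hq.eq_zero]
        rw [← div_eq_mul_inv, le_div_iff₀ hh]
        linarith [not_le.1 hy]
  -- The mesh `4/n` is of smaller order because `c ≥ 1/2`.
  have hmesh : 4 / (n : ℝ) ≤ 8 * h := by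
    have h1 : (1 / (n : ℝ)) ^ 3 ≤ (2 * h) ^ 3 := by
      rw [mul_pow, hhc, div_pow, one_pow, div_mul_eq_mul_div, mul_div_assoc',
        div_le_div_iff₀ (by positivity) (by positivity)]
      have h2 : 1 ≤ 2 ^ 3 * (c * ℓ) := by nlinarith
      have h3 : (n : ℝ) ^ 2 ≤ (n : ℝ) ^ 3 := pow_le_pow_right₀ (by linarith) (by norm_num)
      exact mul_le_mul h2 h3 (by positivity) (by positivity)
    have h2 : 1 / (n : ℝ) ≤ 2 * h :=
      (pow_le_pow_iff_left₀ (by positivity) (by positivity) three_ne_zero).1 h1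
    calc 4 / (n : ℝ) = 4 * (1 / n) := by ring
      _ ≤ 8 * h := by linarith
  refine ⟨fun a => ENNReal.ofReal (E a + 4 / n), ?_, fun a => iSup_le fun z =>
    ENNReal.ofReal_le_ofReal (hdist a z), ?_⟩
  · have hEm : Measurable E := by
      have : Continuous S := continuous_finsetSum _ fun i _ => by
        have := hUc i
        have := hVc i
        fun_prop
      exact ((continuous_const.add (this.const_mul _)).div_const T).measurable
    exact (hEm.add_const _).ennreal_ofReal
  · have hEi' : Integrable (fun a => E a + 4 / n) ν := hEi.add (integrable_const _)
    rw [← ofReal_integral_eq_lintegral_ofReal hEi'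
      (Eventually.of_forall fun a => (abs_nonneg _).trans (hdist a 0)),
      integral_add hEi (integrable_const _)]
    refine ENNReal.ofReal_le_ofReal ?_
    simp only [integral_const, probReal_univ, one_smul]
    linarith

end Kolmogorov

/-! ### Transfer to the probability space -/

section Transfer

open Filter Topology

variable {n : ℕ}

theorem measurable_kantorovichDist_spectralCDF {F : ℝ → ℝ} (hF : Measurable F) :
    Measurable fun a : UpperIndex n → ℝ => kantorovichDist (spectralCDF a) F := by
  unfold kantorovichDist
  have h1 : Measurable fun z : (UpperIndex n → ℝ) × ℝ =>
      ENNReal.ofReal |spectralCDF z.1 z.2 - F z.2| :=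
    (measurable_spectralCDF.sub (hF.comp measurable_snd)).abs.ennreal_ofReal
  exact h1.lintegral_prod_right'

theorem measurable_integral_spectralCDF (ν : Measure (UpperIndex n → ℝ)) [IsProbabilityMeasure ν] :
    Measurable fun x => ∫ b, spectralCDF b x ∂ν :=
  Monotone.measurable fun _ _ h => integral_mono (integrable_spectralCDF ν _)
    (integrable_spectralCDF ν _) fun a => spectralCDF_mono a h

/-- Two functions with values in `[0, 1]` have finite Kolmogorov distance, and it bounds every
pointwise distance. -/
theorem abs_sub_le_toReal_kolmogorovDist {F G : ℝ → ℝ} (hF0 : ∀ x, 0 ≤ F x) (hF1 : ∀ x, F x ≤ 1)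
    (hG0 : ∀ x, 0 ≤ G x) (hG1 : ∀ x, G x ≤ 1) :
    kolmogorovDist F G ≠ ∞ ∧ ∀ x, |F x - G x| ≤ (kolmogorovDist F G).toReal := by
  have hle : kolmogorovDist F G ≤ ENNReal.ofReal 1 := iSup_le fun x =>
    ENNReal.ofReal_le_ofReal (abs_le.2 ⟨by linarith [hF0 x, hG1 x], by linarith [hF1 x, hG0 x]⟩)
  have hfin : kolmogorovDist F G ≠ ∞ := ne_top_of_le_ne_top ENNReal.ofReal_ne_top hle
  refine ⟨hfin, fun x => ?_⟩
  rw [← ENNReal.ofReal_le_iff_le_toReal hfin]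
  exact le_iSup (fun x => ENNReal.ofReal |F x - G x|) x

end Transfer

end

theorem theorem1p3 :
    ∃ C : ℝ, 0 < C ∧
      ∀ (Ω : Type*) [MeasurableSpace Ω] (P : Measure Ω) [IsProbabilityMeasure P]
        (n : ℕ) (_ : 2 ≤ n) (ξ : UpperIndex n → Ω → ℝ)
        (_ : ∀ p, Measurable (ξ p)) (_ : iIndepFun ξ P)
        (_ : ∀ p, ∫ ω, ξ p ω ∂P = 0) (_ : ∀ p, variance (ξ p) P = 1)
        (σ : ℝ) (_ : 0 ≤ σ),
        ((∀ p, PoincareInequality (P.map (ξ p)) (σ ^ 2)) →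
          ∫⁻ ω, kantorovichDist (spectralCDF fun p => ξ p ω) (meanSpectralCDF P ξ) ∂P
            ≤ ENNReal.ofReal (C * σ / (n : ℝ) ^ (2 / 3 : ℝ))) ∧
        ((∀ p, LogSobolevInequality (P.map (ξ p)) (σ ^ 2)) →
          ∫⁻ ω, kolmogorovDist (spectralCDF fun p => ξ p ω) semicircleCDF ∂P
            ≤ ENNReal.ofReal
                (C * (σ / (n : ℝ)) ^ (2 / 3 : ℝ) * (Real.log (n : ℝ)) ^ (1 / 3 : ℝ))
              + kolmogorovDist (meanSpectralCDF P ξ) semicircleCDF) := by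
  obtain ⟨q, q', B, hq⟩ := exists_isRamp
  have hB := hq.pos
  refine ⟨Real.pi + 10 * B ^ 2 + B + 12, by positivity, ?_⟩
  intro Ω _ P _ n hn ξ hξm hind hmean hvar σ hσ
  set μ : UpperIndex n → Measure ℝ := fun p => P.map (ξ p) with hμ
  have hprob : ∀ p, IsProbabilityMeasure (μ p) := fun p =>
    Measure.isProbabilityMeasure_map (hξm p).aemeasurable
  have hlaw : P.map (fun ω p => ξ p ω) = Measure.pi μ :=
    (iIndepFun_iff_map_fun_eq_pi_map fun p => (hξm p).aemeasurable).1 hind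
  have hξ : Measurable fun ω p => ξ p ω := measurable_pi_iff.2 hξm
  have hn0 : (0 : ℝ) < n := by exact_mod_cast (by omega : 0 < n)
  have hn' : n ≠ 0 := by omega
  have hF : meanSpectralCDF P ξ = fun x => ∫ b, spectralCDF b x ∂Measure.pi μ := by
    ext x
    rw [meanSpectralCDF, ← hlaw, integral_map hξ.aemeasurable
      (measurable_spectralCDF_left x).aestronglyMeasurable]
  have h0 : ∀ p, ∫ x, x ∂μ p = 0 := fun p => by
    rw [← hmean p]
    exact integral_map (hξm p).aemeasurable (f := fun x : ℝ => x) (by fun_prop)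
  have h1 : ∀ p, ∫ x, x ^ 2 ∂μ p = 1 := fun p => by
    rw [← hvar p, variance_of_integral_eq_zero (hξm p).aemeasurable (hmean p)]
    exact integral_map (hξm p).aemeasurable (f := fun x : ℝ => x ^ 2) (by fun_prop)
  let p₀ : UpperIndex n := ⟨(⟨0, by omega⟩, ⟨0, by omega⟩), le_rfl⟩
  constructor
  · intro hPI
    have hσ1 : 1 ≤ σ := by
      have := (hPI p₀).one_le (sq_nonneg σ) (h0 p₀) (h1 p₀)
      nlinarith
    rw [hF, ← lintegral_map
      (measurable_kantorovichDist_spectralCDF (measurable_integral_spectralCDF (Measure.pi μ))) hξ,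
      hlaw]
    refine (lintegral_kantorovichDist_spectralCDF_le hq hn' μ hσ1 hPI h1).trans
      (ENNReal.ofReal_le_ofReal ?_)
    gcongr ?_ * σ / _
    linarith
  · intro hLSI
    have hσ2 : 1 ≤ 2 * σ ^ 2 :=
      (hLSI p₀).poincareInequality.one_le (by positivity) (h0 p₀) (h1 p₀)
    have hℓ : 0 < Real.log n := Real.log_pos (by exact_mod_cast (by omega : 1 < n))
    have hσ0 : 0 < σ := lt_of_le_of_ne hσ fun h => by rw [← h] at hσ2; norm_num at hσ2
    set h : ℝ := (σ / n) ^ (2 / 3 : ℝ) * Real.log n ^ (1 / 3 : ℝ) with hh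
    have hh0 : 0 < h := by positivity
    have hh3 : h ^ 3 = σ ^ 2 / (n : ℝ) ^ 2 * Real.log n := by
      rw [hh, mul_pow, ← Real.rpow_natCast, ← Real.rpow_natCast (Real.log n ^ (1 / 3 : ℝ)),
        ← Real.rpow_mul (by positivity), ← Real.rpow_mul hℓ.le, ← div_pow,
        ← Real.rpow_natCast (σ / n)]
      norm_num
    obtain ⟨hfin, hD⟩ := abs_sub_le_toReal_kolmogorovDist
      (F := fun x => ∫ b, spectralCDF b x ∂Measure.pi μ) (G := semicircleCDF)
      (fun x => integral_nonneg fun a => spectralCDF_nonneg a x)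
      (fun x => by
        simpa using integral_mono (integrable_spectralCDF (Measure.pi μ) x)
          (integrable_const (1 : ℝ)) fun a => spectralCDF_le_one a x)
      semicircleCDF_nonneg semicircleCDF_le_one
    obtain ⟨Φ, hΦm, hΦ, hΦi⟩ := exists_kolmogorovDist_spectralCDF_le hq hn μ hσ2 hLSI hh0 hh3 hD
    rw [hF]
    calc _ ≤ ∫⁻ ω, Φ (fun p => ξ p ω) ∂P := lintegral_mono fun ω => hΦ _
      _ = ∫⁻ a, Φ a ∂Measure.pi μ := by rw [← hlaw, lintegral_map hΦm hξ]
      _ ≤ _ := hΦi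
      _ = ENNReal.ofReal ((B + 12) * h) +
          kolmogorovDist (fun x => ∫ b, spectralCDF b x ∂Measure.pi μ) semicircleCDF := by
        rw [ENNReal.ofReal_add (by positivity) ENNReal.toReal_nonneg, ENNReal.ofReal_toReal hfin]
      _ ≤ _ := by
        refine add_le_add (ENNReal.ofReal_le_ofReal ?_) le_rfl
        rw [mul_assoc, ← hh]
        refine mul_le_mul_of_nonneg_right ?_ hh0.le
        nlinarith [Real.pi_pos, sq_nonneg B]
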